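/- **Theorem 3.2.** Let $L=(L_t)_{t\ge 0}$ be a real càdlàg Lévy process with respect to a filtration $(\mathfrak F_t)$ on a probability space $(\Omega,\mathfrak F,P)$, and let $F_L$ be the Lévy measure of $L_1$. Assume that for some $M>0$, $\int_{|x|>1}e^{vx}F_L(dx)<\infty$ for all $|v|\le M$. Write $\mu=\mathbb E L_1$ and $\sigma^2=\operatorname{Var}(L_1)$. Let $\lambda>0$ and let $Y=(Y_t)_{t\ge0}$ satisfy, for every $t\ge 0$, almost surely, $$Y_t=e^{-\lambda t}Y_0+e^{-\lambda t}\int_0^{\lambda t}e^{s}\,dL_s ,$$ where $Y_0$ is independent of $L$ and has the law of $\int_0^\infty e^{-s}\,dL_s$. (Stochastic integrals of deterministic continuous functions are limits in probability of left-endpoint Riemann–Stieltjes sums; the improper integral is the limit in probability of $\int_0^T$ as $T\to\infty$.) Fix an observation step $\Delta>0$ and $d\in\mathbb N_0$, put $X_i=Y_{i\Delta}$, and for $n\ge 1$, $h\in\mathbb N_0$ let $$\bar X_n=\frac1n\sum_{i=1}^n X_i,\qquad \hat\gamma_n(h)=\frac1n\sum_{i=1}^{n-h}(X_{i+h}-\bar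 X_n)(X_i-\bar X_n),\qquad \hat\rho_n(h)=\frac{\hat\gamma_n(h)}{\hat\gamma_n(0)}$$ (the sum is empty if $n\le h$). Then $L_1$ and all $Y_t$ have finite second moments; for all $t\ge0$ and $h\in\mathbb N_0$ the autocovariance is $\gamma(h):=\operatorname{Cov}(Y_{t+h\Delta},Y_t)=\frac{\sigma^2}{2}e^{-\lambda h\Delta}$ and, if $\sigma^2>0$, the autocorrelation is $\rho(h):=\operatorname{Corr}(Y_{t+h\Delta},Y_t)=e^{-\lambda h\Delta}$; and, as $n\to\infty$, 1. $\bar X_n\to\mu$ almost surely; 2. $\frac1n\sum_{i=1}^n(X_i-\bar X_n)^2\to\frac{\sigma^2}{2}$ almost surely; 3. $(\hat\gamma_n(1),\dots,\hat\gamma_n(d))\to(\gamma(1),\dots,\gamma(d))$ almost surely; 4. if $\sigma^2>0$, $(\hat\rho_n(1),\dots,\hat\rho_n(d))\to(\rho(1),\dots,\rho(d))$ almost surely. -/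

import Mathlib

open MeasureTheory ProbabilityTheory Filter Topology Finset
open scoped NNReal ENNReal

noncomputable section

/-- A real-valued càdlàg Lévy process `L = (L_t)_{t ≥ 0}` with respect to the filtration `𝓕`. -/
structure IsLevyProcess {Ω : Type*} {mΩ : MeasurableSpace Ω} (P : Measure Ω)
    (𝓕 : Filtration ℝ≥0 mΩ) (L : ℝ≥0 → Ω → ℝ) : Prop where
  adapted : ∀ t, Measurable[𝓕 t] (L t)
  zero : ∀ᵐ ω ∂P, L 0 ω = 0
  indep_increments : ∀ s t : ℝ≥0, s ≤ t →
    Indep (MeasurableSpace.comap (fun ω => L t ω - L s ω) inferInstance) (𝓕 s) P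
  stationary_increments : ∀ s t : ℝ≥0, s ≤ t →
    IdentDistrib (fun ω => L t ω - L s ω) (L (t - s)) P P
  continuous_in_probability : ∀ t : ℝ≥0, TendstoInMeasure P L (𝓝 t) (L t)
  cadlag : ∀ᵐ ω ∂P, ∀ t : ℝ≥0, Tendsto (fun s => L s ω) (𝓝[>] t) (𝓝 (L t ω)) ∧
    ∃ l : ℝ, Tendsto (fun s => L s ω) (𝓝[<] t) (𝓝 l)

/-- `F` is the Lévy measure of the infinitely divisible law `κ` on `ℝ`: it does not charge `0`,
it integrates `min (1, x²)`, and the Lévy–Khintchine formula holds for `κ` with jump part `F`,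
some drift `b` and some Gaussian variance `c ≥ 0` (truncation function `x 𝟙_{|x| ≤ 1}`). -/
structure HasLevyMeasure (κ : Measure ℝ) (F : Measure ℝ) : Prop where
  zero : F {0} = 0
  lintegral_lt_top : ∫⁻ x, ENNReal.ofReal (min 1 (x ^ 2)) ∂F < ∞
  levyKhintchine : ∃ b c : ℝ, 0 ≤ c ∧ ∀ u : ℝ, charFun κ u =
    Complex.exp (Complex.I * u * b - c * u ^ 2 / 2 +
      ∫ x : ℝ, (Complex.exp (Complex.I * u * x) - 1
        - Complex.I * u * (if |x| ≤ 1 then (x : ℂ) else 0)) ∂F)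

/-- `π 0 ≤ π 1 ≤ ⋯ ≤ π N` is a partition of the interval `[a, b]`. -/
def IsPartition (a b : ℝ≥0) (N : ℕ) (π : ℕ → ℝ≥0) : Prop :=
  Monotone π ∧ π 0 = a ∧ π N = b

/-- The left-endpoint Riemann–Stieltjes sum `∑_{i < N} f(π_i) (L_{π_{i+1}} - L_{π_i})`. -/
def leftSum {Ω : Type*} (f : ℝ → ℝ) (L : ℝ≥0 → Ω → ℝ) (N : ℕ) (π : ℕ → ℝ≥0) (ω : Ω) : ℝ :=
  ∑ i ∈ range N, f (π i) * (L (π (i + 1)) ω - L (π i) ω)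

/-- `J` is (a version of) the stochastic integral `∫_a^b f(s) dL_s` of the continuous
deterministic function `f`: along every sequence of partitions of `[a, b]` whose mesh tends to
`0`, the left-endpoint sums converge to `J` in probability. -/
def IsStochIntegral {Ω : Type*} {mΩ : MeasurableSpace Ω} (P : Measure Ω)
    (f : ℝ → ℝ) (L : ℝ≥0 → Ω → ℝ) (a b : ℝ≥0) (J : Ω → ℝ) : Prop :=
  AEMeasurable J P ∧
  ∀ (N : ℕ → ℕ) (π : ℕ → ℕ → ℝ≥0), (∀ k, IsPartition a b (N k) (π k)) →
    (∀ δ : ℝ, 0 < δ → ∀ᶠ k in atTop, ∀ i < N k, (π k (i + 1) : ℝ) - π k i ≤ δ) →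
    TendstoInMeasure P (fun k => leftSum f L (N k) (π k)) atTop J

/-- `J` is (a version of) the improper stochastic integral `∫_0^∞ f(s) dL_s`, the limit in
probability of `∫_0^T f(s) dL_s` as `T → ∞`. -/
def IsImproperStochIntegral {Ω : Type*} {mΩ : MeasurableSpace Ω} (P : Measure Ω)
    (f : ℝ → ℝ) (L : ℝ≥0 → Ω → ℝ) (J : Ω → ℝ) : Prop :=
  AEMeasurable J P ∧
  ∃ I : ℝ≥0 → Ω → ℝ, (∀ T, IsStochIntegral P f L 0 T (I T)) ∧ TendstoInMeasure P I atTop J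

/-- `Y` is the Ornstein–Uhlenbeck process with rate `lam` driven by `L`: `Y_0` is independent of
`L`, and `Y_t = e^{-λt} Y_0 + e^{-λt} ∫_0^{λt} e^s dL_s` almost surely, for every `t ≥ 0`. -/
structure IsLevyOU {Ω : Type*} {mΩ : MeasurableSpace Ω} (P : Measure Ω)
    (L : ℝ≥0 → Ω → ℝ) (lam : ℝ≥0) (Y : ℝ≥0 → Ω → ℝ) : Prop where
  measurable : ∀ t, Measurable (Y t)
  indep : IndepFun (Y 0) (fun ω t => L t ω) P
  eq_integral : ∀ t : ℝ≥0, ∃ J : Ω → ℝ,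
    IsStochIntegral P (fun s => Real.exp s) L 0 (lam * t) J ∧
    ∀ᵐ ω ∂P, Y t ω = Real.exp (-(lam * t)) * Y 0 ω + Real.exp (-(lam * t)) * J ω

/-- The correlation coefficient of two real random variables. -/
def correlation {Ω : Type*} {mΩ : MeasurableSpace Ω} (X Z : Ω → ℝ) (P : Measure Ω) : ℝ :=
  covariance X Z P / (√(variance X P) * √(variance Z P))

/-- Sample mean `(1/n) ∑_{i=1}^n x_i`. -/
def sampleMean (x : ℕ → ℝ) (n : ℕ) : ℝ :=
  (1 / n) * ∑ i ∈ Icc 1 n, x i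

/-- Sample variance `(1/n) ∑_{i=1}^n (x_i - x̄)²`. -/
def sampleVariance (x : ℕ → ℝ) (n : ℕ) : ℝ :=
  (1 / n) * ∑ i ∈ Icc 1 n, (x i - sampleMean x n) ^ 2

/-- Sample autocovariance `(1/n) ∑_{i=1}^{n-h} (x_{i+h} - x̄)(x_i - x̄)` at lag `h` (the sum is
empty when `n ≤ h`). -/
def sampleAutocov (x : ℕ → ℝ) (n h : ℕ) : ℝ :=
  (1 / n) * ∑ i ∈ Icc 1 (n - h), (x (i + h) - sampleMean x n) * (x i - sampleMean x n)

/-- Sample autocorrelation at lag `h`. -/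
def sampleAutocorr (x : ℕ → ℝ) (n h : ℕ) : ℝ :=
  sampleAutocov x n h / sampleAutocov x n 0

end

/-!
# Strong laws for observations of a stationary Lévy-driven Ornstein–Uhlenbeck process

**Moments.** Exponential moments of the Lévy measure `F` at infinity give `∫ x² dF < ∞`, so the
real part of the characteristic exponent of `L 1` is at least `-C u²`. Hence the characteristic
function of the symmetrisation of `L 1` is `≥ exp (-C u²)`, and Fatou's lemma yields a finite second
moment (`memLp_two_of_hasLevyMeasure`). Means and variances of `L t` are additive in `t`, hence
linear. Left sums of a continuous `f` along uniform partitions are then Cauchy in `L²`, so that the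
stochastic integral over `[a, b]` has mean `μ ∫ f` and variance `σ² ∫ f²`
(`IsStochIntegral.moments`), is independent of the past of `L` up to time `a`
(`IsStochIntegral.indep`), and has a law that depends on the interval only through its length, up
to the scaling of the integrand (`IsStochIntegral.identDistrib`). The last two facts are read off
characteristic functions of left sums, which factorise over the increments.

**Autoregression.** `Y (t + r) = e^{-λ r} Y t + e^{-λ (t + r)} D` with `D` an integral of `e^s` over
`[λ t, λ (t + r)]` (`IsLevyOU.exists_innovation`). Since `L` remains a Lévy process for the filtration
generated by `Y 0` and `L` and completed by null sets (`IsLevyProcess.completedPast`), `D` is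
independent of a `σ`-algebra for which `Y t` is measurable. This gives the autocovariances, and it
exhibits the observations as an autoregressive sequence `X_{i+1} = a X_i + e_i`, with `a = e^{-λ Δ}`
and independent identically distributed square integrable innovations `e_i`.

**Strong laws.** No ergodic theorem is needed. Averages of `e_i` and `e_i²` converge by the strong
law for independent variables; averages of `X_i (e_{i+h} - E e_0)` vanish, because
`∑ X_i (e_{i+h} - E e_0) / (i + 1)` is an `L²`-bounded martingale and Kronecker's lemma applies
(`ae_tendsto_average_mul_innovation`). The recursions for `X_i`, `X_i²` and `X_{i+h} X_i` contract, so
they transfer these limits to the averages of `X_i` and `X_{i+h} X_i`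
(`ae_tendsto_average_of_autoregression`), and the sample statistics are continuous functions of
such averages up to boundary terms.
-/

/-! ### Convergence in probability: characteristic functions and `L²` limits -/

section Convergence

variable {Ω : Type*} {mΩ : MeasurableSpace Ω}

lemma tendsto_integral_cexp_of_tendstoInMeasure {Q : Measure Ω} [IsFiniteMeasure Q]
    {S : ℕ → Ω → ℝ} {J : Ω → ℝ} (hS : ∀ k, AEMeasurable (S k) Q)
    (h : TendstoInMeasure Q S atTop J) (u : ℝ) :
    Tendsto (fun k => ∫ ω, Complex.exp (u * S k ω * Complex.I) ∂Q) atTop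
      (𝓝 (∫ ω, Complex.exp (u * J ω * Complex.I) ∂Q)) := by
  refine tendsto_of_subseq_tendsto fun ns hns => ?_
  obtain ⟨ms, -, hms⟩ := TendstoInMeasure.exists_seq_tendsto_ae
    (f := fun k => S (ns k)) (fun ε hε => (h ε hε).comp hns)
  refine ⟨ms, tendsto_integral_of_dominated_convergence (fun _ => 1) (fun k => ?_)
    (integrable_const _) (fun k => ?_) ?_⟩
  · have := hS (ns (ms k))
    exact AEMeasurable.aestronglyMeasurable (by fun_prop)
  · refine ae_of_all _ fun ω => ?_
    have := Complex.norm_exp_ofReal_mul_I (u * S (ns (ms k)) ω)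
    push_cast at this
    exact this.le
  · filter_upwards [hms] with ω hω
    refine Tendsto.cexp (Tendsto.mul_const _ (Tendsto.const_mul _ ?_))
    exact (Complex.continuous_ofReal.tendsto _).comp hω

lemma TendstoInMeasure.restrict_measure {Q : Measure Ω} {S : ℕ → Ω → ℝ} {J : Ω → ℝ}
    (h : TendstoInMeasure Q S atTop J) (A : Set Ω) :
    TendstoInMeasure (Q.restrict A) S atTop J := fun ε hε =>
  tendsto_of_tendsto_of_tendsto_of_le_of_le tendsto_const_nhds (h ε hε) (fun _ => zero_le)
    fun _ => Measure.restrict_apply_le _ _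

lemma TendstoInMeasure.real_sub {Q : Measure Ω} {S T : ℕ → Ω → ℝ} {J K : Ω → ℝ}
    (hS : TendstoInMeasure Q S atTop J) (hT : TendstoInMeasure Q T atTop K) :
    TendstoInMeasure Q (fun k ω => S k ω - T k ω) atTop (fun ω => J ω - K ω) := by
  intro ε hε
  have hε2 : 0 < ε / 2 := ENNReal.half_pos hε.ne'
  have hsum := (hS _ hε2).add (hT _ hε2)
  rw [add_zero] at hsum
  refine tendsto_of_tendsto_of_tendsto_of_le_of_le tendsto_const_nhds hsum (fun _ => zero_le)
    fun k => (measure_mono fun ω hω => ?_).trans (measure_union_le _ _)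
  by_contra hcon
  simp only [Set.mem_union, Set.mem_ofPred_eq, not_or, not_le] at hcon hω
  refine absurd hω (not_le.2 ?_)
  calc edist (S k ω - T k ω) (J ω - K ω) ≤ edist (S k ω) (J ω) + edist (T k ω) (K ω) := by
        simp only [edist_dist]
        rw [← ENNReal.ofReal_add dist_nonneg dist_nonneg]
        exact ENNReal.ofReal_le_ofReal (dist_sub_sub_le _ _ _ _)
    _ < ε / 2 + ε / 2 := ENNReal.add_lt_add hcon.1 hcon.2
    _ = ε := ENNReal.add_halves ε

variable {P : Measure Ω}

lemma inner_toLp_eq_integral_mul {f g : Ω → ℝ} (hf : MemLp f 2 P) (hg : MemLp g 2 P) :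
    inner ℝ (hf.toLp f) (hg.toLp g) = ∫ ω, f ω * g ω ∂P := by
  rw [L2.inner_def]
  refine integral_congr_ae ?_
  filter_upwards [hf.coeFn_toLp, hg.coeFn_toLp] with ω h1 h2
  simp [h1, h2, mul_comm]

/-- A sequence that is Cauchy in `L²` and converges in probability to `J` converges to `J` in
`L²`; in particular its means and variances converge to those of `J`. -/
lemma moments_of_tendstoInMeasure_of_cauchy [IsProbabilityMeasure P] {S : ℕ → Ω → ℝ} {J : Ω → ℝ}
    (hS : ∀ k, MemLp (S k) 2 P)
    (hC : Tendsto (fun p : ℕ × ℕ => ∫ ω, (S p.1 ω - S p.2 ω) ^ 2 ∂P) atTop (𝓝 0))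
    (hJ : TendstoInMeasure P S atTop J) :
    MemLp J 2 P ∧ Tendsto (fun k => ∫ ω, S k ω ∂P) atTop (𝓝 (∫ ω, J ω ∂P)) ∧
      Tendsto (fun k => variance (S k) P) atTop (𝓝 (variance J P)) := by
  set f : ℕ → Lp ℝ 2 P := fun k => (hS k).toLp (S k) with hf
  have hdist : ∀ k m, dist (f k) (f m) = √(∫ ω, (S k ω - S m ω) ^ 2 ∂P) := by
    intro k m
    rw [dist_eq_norm, hf, ← MemLp.toLp_sub (hS k) (hS m), norm_eq_sqrt_real_inner,
      inner_toLp_eq_integral_mul]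
    simp [sq]
  have hcauchy : CauchySeq f := by
    rw [cauchySeq_iff_tendsto_dist_atTop_0]
    simp_rw [hdist]
    simpa using hC.sqrt
  obtain ⟨g, hg⟩ := cauchySeq_tendsto_of_complete hcauchy
  have hmeas : TendstoInMeasure P S atTop g :=
    (tendstoInMeasure_of_tendsto_Lp hg).congr_left fun k => (hS k).coeFn_toLp
  have hJg : J =ᵐ[P] g := tendstoInMeasure_ae_unique hJ hmeas
  have hJ2 : MemLp J 2 P := (Lp.memLp g).ae_eq hJg.symm
  have hgJ : g = hJ2.toLp J := by
    rw [← Lp.toLp_coeFn g (Lp.memLp g)]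
    exact (MemLp.toLp_eq_toLp_iff _ _).2 hJg.symm
  rw [hgJ] at hg
  have h1 : MemLp (fun _ : Ω => (1 : ℝ)) 2 P := memLp_const 1
  have hmean : Tendsto (fun k => ∫ ω, S k ω ∂P) atTop (𝓝 (∫ ω, J ω ∂P)) := by
    have := hg.inner (𝕜 := ℝ) (tendsto_const_nhds (x := h1.toLp _))
    simp only [hf, inner_toLp_eq_integral_mul, mul_one] at this
    exact this
  have hsq : Tendsto (fun k => ∫ ω, S k ω ^ 2 ∂P) atTop (𝓝 (∫ ω, J ω ^ 2 ∂P)) := by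
    have := hg.inner (𝕜 := ℝ) hg
    simp only [hf, inner_toLp_eq_integral_mul, ← sq] at this
    exact this
  refine ⟨hJ2, hmean, ?_⟩
  simp_rw [fun k => variance_eq_sub (hS k), variance_eq_sub hJ2]
  exact hsq.sub (hmean.pow 2)

/-- Independence of a real random variable from a `σ`-algebra is detected by its characteristic
function on the events of that `σ`-algebra. -/
lemma indep_comap_of_setIntegral_cexp {m : MeasurableSpace Ω} {mΩ : MeasurableSpace Ω}
    {P : Measure Ω} [IsProbabilityMeasure P] {K : Ω → ℝ} (hK : Measurable K)
    (h : ∀ A, MeasurableSet[m] A → ∀ u : ℝ, ∫ ω in A, Complex.exp (u * K ω * Complex.I) ∂P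
      = P.real A * ∫ ω, Complex.exp (u * K ω * Complex.I) ∂P) :
    Indep (MeasurableSpace.comap K inferInstance) m P := by
  rw [Indep_iff]
  rintro _ A ⟨B, hB, rfl⟩ hA
  have key : (P.restrict A).map K = P A • P.map K := by
    have : IsFiniteMeasure (P A • P.map K) := Measure.smul_finite _ (measure_ne_top _ _)
    refine Measure.ext_of_charFun (funext fun u => ?_)
    have hc : Continuous fun x : ℝ => Complex.exp (u * x * Complex.I) := by fun_prop
    simp only [charFun_apply_real]
    rw [integral_map hK.aemeasurable hc.aestronglyMeasurable, integral_smul_measure,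
      integral_map hK.aemeasurable hc.aestronglyMeasurable, h A hA u]
    simp [Measure.real]
  have := congrArg (fun ν => ν B) key
  simp only [Measure.smul_apply, smul_eq_mul] at this
  rw [Measure.map_apply hK hB, Measure.map_apply hK hB, Measure.restrict_apply (hK hB)] at this
  rw [this, mul_comm]

end Convergence

/-! ### Finite second moments -/

section SecondMoment

lemma eLpNorm_two_eq_sqrt_integral_sq {Ω : Type*} {mΩ : MeasurableSpace Ω} {P : Measure Ω}
    {f : Ω → ℝ} (hf : MemLp f 2 P) :
    eLpNorm f 2 P = ENNReal.ofReal √(∫ ω, f ω ^ 2 ∂P) := by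
  rw [hf.eLpNorm_eq_integral_rpow_norm (by simp) (by simp), Real.sqrt_eq_rpow]
  simp

/-- If `X + Y` is square integrable and `X`, `Y` are independent, then `X` is square integrable:
by Fubini, `X + y` is square integrable for some constant `y`. -/
lemma memLp_two_of_indepFun_add {Ω : Type*} {mΩ : MeasurableSpace Ω} {P : Measure Ω}
    [IsProbabilityMeasure P] {X Y : Ω → ℝ} (hX : Measurable X) (hY : Measurable Y)
    (hXY : IndepFun X Y P) (h : MemLp (fun ω => X ω + Y ω) 2 P) : MemLp X 2 P := by
  have hlaw := (indepFun_iff_map_prod_eq_prod_map_map hX.aemeasurable hY.aemeasurable).1 hXY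
  have h2 : Integrable (fun p : ℝ × ℝ => (p.1 + p.2) ^ 2) ((P.map X).prod (P.map Y)) := by
    rw [← hlaw, integrable_map_measure (by fun_prop) (by fun_prop)]
    exact h.integrable_sq
  have : IsProbabilityMeasure (P.map X) := Measure.isProbabilityMeasure_map hX.aemeasurable
  have : IsProbabilityMeasure (P.map Y) := Measure.isProbabilityMeasure_map hY.aemeasurable
  obtain ⟨y, hy⟩ := h2.prod_left_ae.exists
  have hXy : MemLp (fun ω => X ω + y) 2 P := by
    rw [memLp_two_iff_integrable_sq (by fun_prop)]
    exact (integrable_map_measure (by fun_prop) (by fun_prop)).1 hy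
  refine (hXy.sub (memLp_const y)).congr_norm hX.aestronglyMeasurable (ae_of_all _ fun ω => ?_)
  simp

/-- A probability measure on `ℝ` whose characteristic function satisfies
`exp (-C u²) ≤ |φ(u)|²` has a finite second moment: `|φ|²` is the characteristic function of the
symmetrisation `X - X'`, Fatou's lemma applied to `(1 - cos (u (X - X'))) / u²` bounds the second
moment of `X - X'`, and Fubini's theorem gives that of `X`. -/
lemma memLp_two_of_exp_le_normSq_charFun {κ : Measure ℝ} [IsProbabilityMeasure κ] {C : ℝ}
    (h : ∀ u : ℝ, Real.exp (-(C * u ^ 2)) ≤ ‖charFun κ u‖ ^ 2) : MemLp id 2 κ := by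
  have hcos : ∀ u : ℝ, ∫ p : ℝ × ℝ, (1 - Real.cos (u * (p.1 - p.2))) ∂(κ.prod κ)
      ≤ C * u ^ 2 := by
    intro u
    have hint : Integrable (fun p : ℝ × ℝ => Real.cos (u * (p.1 - p.2))) (κ.prod κ) :=
      Integrable.of_bound (by fun_prop) 1 (ae_of_all _ fun p => by
        simpa using Real.abs_cos_le_one _)
    have h1 : (∫ p : ℝ × ℝ, Real.cos (u * (p.1 - p.2)) ∂(κ.prod κ)) = ‖charFun κ u‖ ^ 2 := by
      have h2 : (∫ p : ℝ × ℝ, Complex.exp (u * p.1 * Complex.I)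
          * Complex.exp ((-u : ℝ) * p.2 * Complex.I) ∂(κ.prod κ))
          = charFun κ u * charFun κ (-u) := by
        rw [integral_prod_mul (fun x : ℝ => Complex.exp (u * x * Complex.I))
          (fun x : ℝ => Complex.exp ((-u : ℝ) * x * Complex.I))]
        simp only [charFun_apply_real]
      rw [charFun_neg, Complex.mul_conj, Complex.normSq_eq_norm_sq] at h2
      have h3 := congrArg Complex.re h2
      rw [Complex.ofReal_re] at h3
      rw [← h3]
      have hint2 : Integrable (fun p : ℝ × ℝ => Complex.exp (u * p.1 * Complex.I)
          * Complex.exp ((-u : ℝ) * p.2 * Complex.I)) (κ.prod κ) := by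
        refine Integrable.of_bound (by fun_prop) 1 (ae_of_all _ fun p => ?_)
        have e1 := Complex.norm_exp_ofReal_mul_I (u * p.1)
        have e2 := Complex.norm_exp_ofReal_mul_I (-u * p.2)
        push_cast at e1 e2 ⊢
        rw [norm_mul, e1, e2, one_mul]
      refine Eq.trans ?_ (integral_re hint2)
      refine integral_congr_ae (ae_of_all _ fun p => ?_)
      simp only [RCLike.re_to_complex]
      rw [← Complex.exp_add, ← Complex.exp_ofReal_mul_I_re]
      congr 2
      push_cast; ring
    rw [integral_sub (integrable_const _) hint, h1]
    have := h u
    have h4 := Real.add_one_le_exp (-(C * u ^ 2))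
    simp only [integral_const, probReal_univ, smul_eq_mul, one_mul]
    linarith
  have hfat : MemLp (fun p : ℝ × ℝ => p.1 + -p.2) 2 (κ.prod κ) := by
    set f : ℕ → ℝ × ℝ → ℝ := fun n p => (n : ℝ) * Real.sin ((n : ℝ)⁻¹ * (p.1 - p.2)) with hf
    have hfm : ∀ n, MemLp (f n) 2 (κ.prod κ) := fun n =>
      MemLp.of_bound (by fun_prop) n (ae_of_all _ fun p => by
        rw [hf, norm_mul, Real.norm_natCast, Real.norm_eq_abs]
        exact mul_le_of_le_one_right (Nat.cast_nonneg n) (Real.abs_sin_le_one _))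
    refine ⟨by fun_prop, lt_of_le_of_lt (Lp.eLpNorm_le_of_ae_tendsto (f := f)
      (C := ENNReal.ofReal √(2 * C)) (u := atTop) ?_ (fun n => (hfm n).1)
      (ae_of_all _ fun p => ?_)) ENNReal.ofReal_lt_top⟩
    · filter_upwards [eventually_gt_atTop 0] with n hn
      have hn' : (0 : ℝ) < n := by exact_mod_cast hn
      rw [eLpNorm_two_eq_sqrt_integral_sq (hfm n)]
      refine ENNReal.ofReal_le_ofReal (Real.sqrt_le_sqrt ?_)
      have h1 : ∀ p : ℝ × ℝ, f n p ^ 2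
          = (n : ℝ) ^ 2 / 2 * (1 - Real.cos ((2 * (n : ℝ)⁻¹) * (p.1 - p.2))) := by
        intro p
        rw [hf, mul_assoc, Real.cos_two_mul, Real.cos_sq']
        ring
      simp_rw [h1]
      rw [integral_const_mul]
      refine (mul_le_mul_of_nonneg_left (hcos _) (by positivity)).trans (le_of_eq ?_)
      field_simp
    · have hd : HasFDerivAt Real.sin (ContinuousLinearMap.toSpanSingleton ℝ (1 : ℝ)) 0 := by
        have := (Real.hasDerivAt_sin 0).hasFDerivAt
        rwa [Real.cos_zero] at this
      have := (hd.lim_real (p.1 - p.2)).comp tendsto_natCast_atTop_atTop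
      simpa [Function.comp_def, hf, sub_eq_add_neg] using this
  have hid : MemLp (fun p : ℝ × ℝ => p.1) 2 (κ.prod κ) := by
    refine memLp_two_of_indepFun_add measurable_fst measurable_snd.neg ?_ hfat
    exact (indepFun_prod measurable_id measurable_neg)
  rw [← (measurePreserving_fst (μ := κ) (ν := κ)).map_eq]
  exact (memLp_map_measure_iff (by fun_prop) (by fun_prop)).2 hid

/-- A law whose Lévy measure has exponential moments near infinity has a finite second moment:
the real part of its characteristic exponent is at least `-(c + ∫ x² dF) u² / 2`. -/
lemma memLp_two_of_hasLevyMeasure {κ F : Measure ℝ} [IsProbabilityMeasure κ]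
    (hF : HasLevyMeasure κ F) {M : ℝ} (hM : 0 < M)
    (hexp : ∀ v : ℝ, |v| ≤ M → IntegrableOn (fun x : ℝ => Real.exp (v * x)) {x | 1 < |x|} F) :
    MemLp id 2 κ := by
  have hsq : Integrable (fun x : ℝ => x ^ 2) F := by
    have hmin : Integrable (fun x : ℝ => min 1 (x ^ 2)) F := by
      refine ⟨by fun_prop, ?_⟩
      rw [hasFiniteIntegral_iff_ofReal (ae_of_all _ fun x => by positivity)]
      exact hF.lintegral_lt_top
    have hms : MeasurableSet {x : ℝ | 1 < |x|} := measurableSet_lt (by fun_prop) (by fun_prop)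
    have hin : IntegrableOn (fun x : ℝ => x ^ 2) {x | 1 < |x|}ᶜ F := by
      refine hmin.integrableOn.congr_fun (fun x hx => ?_) hms.compl
      have hx1 : |x| ≤ 1 := by simpa using hx
      exact min_eq_right ((sq_le_one_iff_abs_le_one x).2 hx1)
    have hout : IntegrableOn (fun x : ℝ => x ^ 2) {x | 1 < |x|} F := by
      have h1 := ((hexp M (abs_of_pos hM).le).add
        (hexp (-M) (by rw [abs_neg, abs_of_pos hM]))).const_mul (2 / M ^ 2)
      refine h1.mono' (by fun_prop) (ae_of_all _ fun x => ?_)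
      rw [Real.norm_of_nonneg (sq_nonneg x)]
      -- the quadratic term of the exponential series at `M |x|` dominates `x²`
      have h2 := Real.quadratic_le_exp_of_nonneg (mul_nonneg hM.le (abs_nonneg x))
      have h3 : Real.exp (M * |x|) ≤ Real.exp (M * x) + Real.exp (-M * x) := by
        rcases abs_cases x with ⟨h, -⟩ | ⟨h, -⟩ <;> rw [h]
        · linarith [Real.exp_pos (-M * x)]
        · rw [mul_neg, ← neg_mul]; linarith [Real.exp_pos (M * x)]
      have h4 : (M * |x|) ^ 2 = M ^ 2 * x ^ 2 := by rw [mul_pow, sq_abs]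
      have h5 : 0 ≤ M * |x| := by positivity
      simp only [Pi.add_apply]
      rw [div_mul_eq_mul_div, le_div_iff₀ (by positivity)]
      nlinarith
    rw [← integrableOn_univ, ← Set.union_compl_self {x : ℝ | 1 < |x|}]
    exact hout.union hin
  obtain ⟨b, c, hc, hφ⟩ := hF.levyKhintchine
  refine memLp_two_of_exp_le_normSq_charFun (C := c + ∫ x, x ^ 2 ∂F) fun u => ?_
  rw [hφ u, Complex.norm_exp, ← Real.exp_nat_mul]
  refine Real.exp_le_exp.2 ?_
  set g : ℝ → ℂ := fun x => Complex.exp (Complex.I * u * x) - 1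
        - Complex.I * u * (if |x| ≤ 1 then (x : ℂ) else 0) with hg
  have hre : ∀ x, (g x).re = Real.cos (u * x) - 1 := by
    intro x
    have : Complex.I * u * (x : ℂ) = ((u * x : ℝ) : ℂ) * Complex.I := by push_cast; ring
    rw [hg]
    simp only [this, Complex.sub_re, Complex.exp_ofReal_mul_I_re, Complex.one_re]
    split_ifs <;> simp
  have hint : -(u ^ 2 / 2 * ∫ x, x ^ 2 ∂F) ≤ (∫ x, g x ∂F).re := by
    by_cases hgi : Integrable g F
    · have h1 := integral_re hgi
      simp only [RCLike.re_to_complex] at h1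
      rw [← h1, ← integral_const_mul, ← integral_neg]
      refine integral_mono (hsq.const_mul _).neg hgi.re fun x => ?_
      simp only [hre]
      have := Real.one_sub_sq_div_two_le_cos (x := u * x)
      nlinarith
    · rw [integral_undef hgi, Complex.zero_re]
      have : 0 ≤ ∫ x, x ^ 2 ∂F := integral_nonneg fun x => sq_nonneg x
      have : 0 ≤ u ^ 2 / 2 * ∫ x, x ^ 2 ∂F := by positivity
      linarith
  have hre2 : (Complex.I * u * b - c * u ^ 2 / 2 + ∫ x, g x ∂F).re
      = -(c * u ^ 2 / 2) + (∫ x, g x ∂F).re := by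
    have : Complex.I * u * b - c * u ^ 2 / 2
        = ((u * b : ℝ) : ℂ) * Complex.I - ((c * u ^ 2 / 2 : ℝ) : ℂ) := by push_cast; ring
    rw [this, Complex.add_re, Complex.sub_re, Complex.ofReal_re, Complex.re_ofReal_mul]
    simp
  rw [hre2]
  push_cast
  nlinarith

end SecondMoment

/-! ### Moments of a Lévy process and of sums over its increments -/

section LevyMoments

/-- An additive function on `[0, ∞)` that is bounded on `[0, 1]` is linear. -/
lemma eq_mul_of_additive_of_bounded {f : ℝ≥0 → ℝ} (hadd : ∀ s t, f (s + t) = f s + f t) {B : ℝ}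
    (hB : ∀ t ≤ 1, |f t| ≤ B) (t : ℝ≥0) : f t = t * f 1 := by
  have hnat : ∀ (n : ℕ) (s : ℝ≥0), f (n * s) = n * f s := by
    intro n s
    induction n with
    | zero => simpa using hadd 0 0
    | succ n ih => rw [Nat.cast_succ, add_mul, one_mul, hadd, ih]; push_cast; ring
  -- `n t = ⌊n t⌋ + r` with `0 ≤ r ≤ 1`, so that `n |f t - t f 1|` is bounded in `n`
  have hbound : ∀ n : ℕ, n * |f t - t * f 1| ≤ B + |f 1| := by
    intro n
    obtain ⟨r, hr⟩ := exists_add_of_le (Nat.floor_le (zero_le : 0 ≤ (n : ℝ≥0) * t))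
    have hr1 : r ≤ 1 := by
      have h1 := Nat.lt_floor_add_one ((n : ℝ≥0) * t)
      have h2 : (⌊(n : ℝ≥0) * t⌋₊ : ℝ≥0) + r < ⌊(n : ℝ≥0) * t⌋₊ + 1 := by rwa [← hr]
      exact (lt_of_add_lt_add_left h2).le
    have h1 : n * f t = ⌊(n : ℝ≥0) * t⌋₊ * f 1 + f r := by
      rw [← hnat n t, ← hnat _ 1, ← hadd, mul_one, ← hr]
    have h2 : (n : ℝ) * t = ⌊(n : ℝ≥0) * t⌋₊ + r := by exact_mod_cast congrArg NNReal.toReal hr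
    have h3 : n * (f t - t * f 1) = f r - r * f 1 := by linear_combination h1 - f 1 * h2
    have h4 : |(r : ℝ) * f 1| ≤ |f 1| := by
      rw [abs_mul, NNReal.abs_eq]
      exact mul_le_of_le_one_left (abs_nonneg _) (by exact_mod_cast hr1)
    calc n * |f t - t * f 1| = |n * (f t - t * f 1)| := by rw [abs_mul, Nat.abs_cast]
      _ ≤ |f r| + |r * f 1| := by rw [h3]; exact abs_sub _ _
      _ ≤ B + |f 1| := add_le_add (hB r hr1) h4
  by_contra hne
  have hpos : 0 < |f t - t * f 1| := abs_pos.2 (sub_ne_zero.2 hne)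
  obtain ⟨n, hn⟩ := exists_nat_gt ((B + |f 1|) / |f t - t * f 1|)
  rw [div_lt_iff₀ hpos] at hn
  exact absurd (hbound n) (not_le.2 hn)

variable {Ω : Type*} {mΩ : MeasurableSpace Ω} {P : Measure Ω} {𝓕 : Filtration ℝ≥0 mΩ}
  {L : ℝ≥0 → Ω → ℝ}

namespace IsLevyProcess

lemma measurable (hL : IsLevyProcess P 𝓕 L) (t : ℝ≥0) : Measurable (L t) :=
  (hL.adapted t).mono (𝓕.le t) le_rfl

lemma indepFun_increment (hL : IsLevyProcess P 𝓕 L) {s t : ℝ≥0} (hst : s ≤ t) {β : Type*}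
    [MeasurableSpace β] {X : Ω → β} (hX : Measurable[𝓕 s] X) :
    IndepFun X (fun ω => L t ω - L s ω) P :=
  (indep_of_indep_of_le_right (hL.indep_increments s t hst) hX.comap_le).symm

variable [IsProbabilityMeasure P]

lemma memLp_two (hL : IsLevyProcess P 𝓕 L) (h1 : MemLp (L 1) 2 P) (t : ℝ≥0) :
    MemLp (L t) 2 P := by
  have hnat : ∀ n : ℕ, MemLp (L n) 2 P := by
    intro n
    induction n with
    | zero =>
      refine (MemLp.zero (ε := ℝ)).ae_eq ?_
      filter_upwards [hL.zero] with ω hω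
      simp [hω]
    | succ n ih =>
      have hid := hL.stationary_increments n (n + 1) (by simp)
      rw [add_tsub_cancel_left] at hid
      have := ih.add (hid.symm.memLp_snd h1)
      convert this using 1
      ext ω
      simp
  obtain ⟨n, hn⟩ := exists_nat_ge t
  refine memLp_two_of_indepFun_add (Y := fun ω => L n ω - L t ω) (hL.measurable t)
    ((hL.measurable n).sub (hL.measurable t)) (hL.indepFun_increment hn (hL.adapted t)) ?_
  simpa using hnat n

lemma memLp_two_increment (hL : IsLevyProcess P 𝓕 L) (h1 : MemLp (L 1) 2 P) (s t : ℝ≥0) :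
    MemLp (fun ω => L t ω - L s ω) 2 P :=
  (hL.memLp_two h1 t).sub (hL.memLp_two h1 s)

lemma variance_eq (hL : IsLevyProcess P 𝓕 L) (h1 : MemLp (L 1) 2 P) (t : ℝ≥0) :
    variance (L t) P = t * variance (L 1) P := by
  have hadd : ∀ s t, variance (L (s + t)) P = variance (L s) P + variance (L t) P := by
    intro s t
    have hid := hL.stationary_increments s (s + t) le_self_add
    rw [add_tsub_cancel_left] at hid
    rw [← hid.variance_eq, ← IndepFun.variance_add (hL.memLp_two h1 s)
      (hL.memLp_two_increment h1 _ _) (hL.indepFun_increment le_self_add (hL.adapted s))]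
    congr 1
    ext ω
    simp
  refine eq_mul_of_additive_of_bounded (f := fun t => variance (L t) P) hadd
    (B := variance (L 1) P) (fun t ht => ?_) t
  obtain ⟨r, hr⟩ := exists_add_of_le ht
  rw [abs_of_nonneg (variance_nonneg _ _), hr, hadd]
  linarith [variance_nonneg (L r) P]

lemma integral_eq (hL : IsLevyProcess P 𝓕 L) (h1 : MemLp (L 1) 2 P) (t : ℝ≥0) :
    ∫ ω, L t ω ∂P = t * ∫ ω, L 1 ω ∂P := by
  have hint : ∀ t, Integrable (L t) P := fun t => (hL.memLp_two h1 t).integrable (by simp)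
  have hadd : ∀ s t, ∫ ω, L (s + t) ω ∂P = ∫ ω, L s ω ∂P + ∫ ω, L t ω ∂P := by
    intro s t
    have hid := hL.stationary_increments s (s + t) le_self_add
    rw [add_tsub_cancel_left] at hid
    rw [← hid.integral_eq, ← integral_add (hint s) (f := L s)
      (g := fun ω => L (s + t) ω - L s ω) ((hint _).sub (hint _))]
    simp
  have hnat : ∀ (n : ℕ) (s : ℝ≥0), ∫ ω, L (n * s) ω ∂P = n * ∫ ω, L s ω ∂P := by
    intro n s
    induction n with
    | zero => simpa using hadd 0 0
    | succ n ih => rw [Nat.cast_succ, add_mul, one_mul, hadd, ih]; push_cast; ring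
  -- near `0`, `L_t` is close to `0` by stochastic continuity and to its mean by Chebyshev's
  -- inequality, so the mean is bounded there
  set v := variance (L 1) P with hv
  have hv0 : 0 ≤ v := variance_nonneg _ _
  have hsmall : ∀ᶠ t in 𝓝 (0 : ℝ≥0), |∫ ω, L t ω ∂P| ≤ 1 + 2 * (v + 1) := by
    have h2 := hL.continuous_in_probability 0 1 one_pos
    have h3 : ∀ᶠ t in 𝓝 (0 : ℝ≥0), P {ω | 1 ≤ edist (L t ω) (L 0 ω)} < ENNReal.ofReal (1 / 4) :=
      h2.eventually (gt_mem_nhds (by simp))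
    filter_upwards [h3, Iic_mem_nhds (show (0 : ℝ≥0) < 1 by norm_num)] with t ht ht1
    have hcheb := meas_ge_le_variance_div_sq (hL.memLp_two h1 t)
      (c := 2 * (v + 1)) (by positivity)
    have hle : variance (L t) P / (2 * (v + 1)) ^ 2 ≤ 1 / 4 := by
      rw [hL.variance_eq h1 t, div_le_iff₀ (by positivity)]
      have : (t : ℝ) ≤ 1 := by exact_mod_cast ht1
      nlinarith [mul_le_mul_of_nonneg_right this hv0]
    have hunion : P ({ω | 1 ≤ edist (L t ω) (L 0 ω)} ∪
        {ω | 2 * (v + 1) ≤ |L t ω - ∫ ω, L t ω ∂P|}) < 1 := by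
      refine (measure_union_le _ _).trans_lt ?_
      calc _ < ENNReal.ofReal (1 / 4) + ENNReal.ofReal (1 / 4) :=
            ENNReal.add_lt_add_of_lt_of_le (by simp) ht
              (hcheb.trans (ENNReal.ofReal_le_ofReal hle))
        _ ≤ 1 := by
          rw [← ENNReal.ofReal_add (by norm_num) (by norm_num), ← ENNReal.ofReal_one]
          exact ENNReal.ofReal_le_ofReal (by norm_num)
    have hex : ∃ ω, ω ∉ ({ω | 1 ≤ edist (L t ω) (L 0 ω)} ∪
        {ω | 2 * (v + 1) ≤ |L t ω - ∫ ω, L t ω ∂P|}) ∧ L 0 ω = 0 := by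
      by_contra! hcon
      refine absurd hunion (not_lt.2 ?_)
      have : ({ω | 1 ≤ edist (L t ω) (L 0 ω)} ∪
        {ω | 2 * (v + 1) ≤ |L t ω - ∫ ω, L t ω ∂P|} : Set Ω) =ᵐ[P] Set.univ := by
        refine eventuallyEq_univ.2 ?_
        filter_upwards [hL.zero] with ω hω
        by_contra hω2
        exact hcon ω hω2 hω
      rw [measure_congr this, measure_univ]
    obtain ⟨ω, hω, hω0⟩ := hex
    simp only [Set.mem_union, Set.mem_ofPred_eq, not_or, not_le] at hω
    obtain ⟨ha, hb⟩ := hω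
    rw [hω0, edist_dist, ← ENNReal.ofReal_one, ENNReal.ofReal_lt_ofReal_iff one_pos,
      Real.dist_eq, sub_zero] at ha
    rw [abs_lt] at ha hb
    rw [abs_le]
    constructor <;> linarith
  obtain ⟨δ, hδ, hδ2⟩ := Metric.eventually_nhds_iff.1 hsmall
  obtain ⟨n, hn⟩ := exists_nat_gt (1 / δ)
  have hn0 : (0 : ℝ) < n := lt_trans (by positivity) hn
  refine eq_mul_of_additive_of_bounded (f := fun t => ∫ ω, L t ω ∂P) hadd
    (B := n * (1 + 2 * (v + 1))) (fun t ht => ?_) t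
  have hn1 : (n : ℝ≥0) * (t / n) = t := mul_div_cancel₀ _ (by exact_mod_cast hn0.ne')
  have h5 : |∫ ω, L (t / n) ω ∂P| ≤ 1 + 2 * (v + 1) := by
    refine hδ2 ?_
    rw [NNReal.dist_eq, NNReal.coe_zero, sub_zero, NNReal.abs_eq, NNReal.coe_div,
      NNReal.coe_natCast]
    have ht' : (t : ℝ) ≤ 1 := by exact_mod_cast ht
    rw [div_lt_iff₀ hδ] at hn
    rw [div_lt_iff₀ hn0]
    linarith
  rw [← hn1, hnat, abs_mul, Nat.abs_cast]
  exact mul_le_mul_of_nonneg_left h5 hn0.le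

lemma integral_increment (hL : IsLevyProcess P 𝓕 L) (h1 : MemLp (L 1) 2 P) {s t : ℝ≥0}
    (hst : s ≤ t) : ∫ ω, (L t ω - L s ω) ∂P = (t - s) * ∫ ω, L 1 ω ∂P := by
  rw [(hL.stationary_increments s t hst).integral_eq, hL.integral_eq h1, NNReal.coe_sub hst]

lemma variance_increment (hL : IsLevyProcess P 𝓕 L) (h1 : MemLp (L 1) 2 P) {s t : ℝ≥0}
    (hst : s ≤ t) : variance (fun ω => L t ω - L s ω) P = (t - s) * variance (L 1) P := by
  rw [(hL.stationary_increments s t hst).variance_eq, hL.variance_eq h1, NNReal.coe_sub hst]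

end IsLevyProcess

/-- The sum `∑_{i < N} c_i (L_{π_{i+1}} - L_{π_i})`. -/
def incrementSum (c : ℕ → ℝ) (L : ℝ≥0 → Ω → ℝ) (π : ℕ → ℝ≥0) (N : ℕ) (ω : Ω) : ℝ :=
  ∑ i ∈ range N, c i * (L (π (i + 1)) ω - L (π i) ω)

lemma leftSum_eq_incrementSum (f : ℝ → ℝ) (N : ℕ) (π : ℕ → ℝ≥0) :
    leftSum f L N π = incrementSum (fun i => f (π i)) L π N := rfl

lemma incrementSum_succ (c : ℕ → ℝ) (π : ℕ → ℝ≥0) (N : ℕ) :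
    incrementSum c L π (N + 1) =
      incrementSum c L π N + fun ω => c N * (L (π (N + 1)) ω - L (π N) ω) := by
  ext ω
  simp [incrementSum, sum_range_succ]

namespace IsLevyProcess

lemma measurable_incrementSum (hL : IsLevyProcess P 𝓕 L) (c : ℕ → ℝ) {π : ℕ → ℝ≥0}
    (hπ : Monotone π) (N : ℕ) : Measurable[𝓕 (π N)] (incrementSum c L π N) := by
  refine Finset.measurable_sum _ fun i hi => ?_
  have hi := mem_range.1 hi
  exact (((hL.adapted _).mono (𝓕.mono (hπ (by omega))) le_rfl).sub
    ((hL.adapted _).mono (𝓕.mono (hπ (by omega))) le_rfl)).const_mul _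

/-- The characteristic function of a sum over increments, localised to an event of the past,
factorises. -/
lemma setIntegral_cexp_incrementSum (hL : IsLevyProcess P 𝓕 L) (c : ℕ → ℝ)
    {π : ℕ → ℝ≥0} (hπ : Monotone π) (N : ℕ) {A : Set Ω} (hA : MeasurableSet[𝓕 (π 0)] A) (u : ℝ) :
    ∫ ω in A, Complex.exp (u * incrementSum c L π N ω * Complex.I) ∂P =
      P.real A * ∏ i ∈ range N, charFun (P.map (L (π (i + 1) - π i))) (u * c i) := by
  have hAm : MeasurableSet A := 𝓕.le _ _ hA
  have hm : Measurable fun x : ℝ => Complex.exp (u * x * Complex.I) := by fun_prop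
  induction N with
  | zero => simp [incrementSum]
  | succ N ih =>
    rw [prod_range_succ, ← mul_assoc, ← ih, ← integral_indicator hAm, ← integral_indicator hAm]
    have hX : Measurable[𝓕 (π N)]
        (A.indicator fun ω => Complex.exp (u * incrementSum c L π N ω * Complex.I)) :=
      (hm.comp (hL.measurable_incrementSum c hπ N)).indicator (𝓕.mono (hπ N.zero_le) _ hA)
    have hm2 : Measurable fun x : ℝ => Complex.exp ((u * c N : ℝ) * x * Complex.I) := by fun_prop
    have hinc : Measurable fun ω => L (π (N + 1)) ω - L (π N) ω :=
      (hL.measurable _).sub (hL.measurable _)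
    have hind := (hL.indepFun_increment (hπ N.le_succ) hX).comp measurable_id hm2
    have := hind.integral_fun_mul_eq_mul_integral
      ((hX.mono (𝓕.le _) le_rfl).aestronglyMeasurable) (hm2.comp hinc).aestronglyMeasurable
    simp only [Function.comp_def, id] at this
    rw [← (hL.stationary_increments _ _ (hπ N.le_succ)).map_eq, charFun_apply_real,
      integral_map hinc.aemeasurable hm2.aestronglyMeasurable, ← this]
    refine integral_congr_ae (ae_of_all _ fun ω => ?_)
    by_cases hω : ω ∈ A
    · simp only [Set.indicator_of_mem hω]
      rw [← Complex.exp_add, incrementSum_succ]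
      congr 1
      simp only [Pi.add_apply]
      push_cast
      ring
    · simp [Set.indicator_of_notMem hω]

variable [IsProbabilityMeasure P]

lemma memLp_incrementSum (hL : IsLevyProcess P 𝓕 L) (h1 : MemLp (L 1) 2 P) (c : ℕ → ℝ)
    (π : ℕ → ℝ≥0) (N : ℕ) : MemLp (incrementSum c L π N) 2 P :=
  memLp_finsetSum _ fun _ _ => (hL.memLp_two_increment h1 _ _).const_mul _

lemma integral_incrementSum (hL : IsLevyProcess P 𝓕 L) (h1 : MemLp (L 1) 2 P) (c : ℕ → ℝ)
    {π : ℕ → ℝ≥0} (hπ : Monotone π) (N : ℕ) :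
    ∫ ω, incrementSum c L π N ω ∂P =
      (∑ i ∈ range N, c i * ((π (i + 1) : ℝ) - π i)) * ∫ ω, L 1 ω ∂P := by
  simp only [incrementSum]
  rw [integral_finsetSum _ fun i _ =>
    ((hL.memLp_two_increment h1 _ _).integrable (by simp)).const_mul _, sum_mul]
  refine sum_congr rfl fun i _ => ?_
  rw [integral_const_mul, hL.integral_increment h1 (hπ i.le_succ), mul_assoc]

lemma variance_incrementSum (hL : IsLevyProcess P 𝓕 L) (h1 : MemLp (L 1) 2 P) (c : ℕ → ℝ)
    {π : ℕ → ℝ≥0} (hπ : Monotone π) (N : ℕ) :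
    variance (incrementSum c L π N) P =
      (∑ i ∈ range N, c i ^ 2 * ((π (i + 1) : ℝ) - π i)) * variance (L 1) P := by
  induction N with
  | zero =>
    have : incrementSum c L π 0 = 0 := by ext ω; simp [incrementSum]
    simp [this, variance_zero]
  | succ N ih =>
    rw [incrementSum_succ, IndepFun.variance_add (hL.memLp_incrementSum h1 _ _ _)
      ((hL.memLp_two_increment h1 _ _).const_mul _), ih, variance_const_mul,
      hL.variance_increment h1 (hπ N.le_succ), sum_range_succ]
    · ring
    · exact (hL.indepFun_increment (hπ N.le_succ) (hL.measurable_incrementSum c hπ N)).comp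
        measurable_id (measurable_const_mul (c N))

end IsLevyProcess

end LevyMoments

/-! ### Stochastic integrals of continuous functions along uniform partitions -/

section StochIntegral

/-- The partition of `[a, a + s]` into `n` intervals of equal length. -/
noncomputable def uniformPartition (a s : ℝ≥0) (n i : ℕ) : ℝ≥0 := a + s * (i / n)

lemma uniformPartition_monotone (a s : ℝ≥0) (n : ℕ) : Monotone (uniformPartition a s n) := by
  intro i j hij
  unfold uniformPartition
  gcongr

@[simp] lemma uniformPartition_zero (a s : ℝ≥0) (n : ℕ) : uniformPartition a s n 0 = a := by
  simp [uniformPartition]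

lemma isPartition_uniformPartition (a s : ℝ≥0) {n : ℕ} (hn : 0 < n) :
    IsPartition a (a + s) n (uniformPartition a s n) := by
  refine ⟨uniformPartition_monotone a s n, uniformPartition_zero a s n, ?_⟩
  rw [uniformPartition, div_self (by exact_mod_cast hn.ne'), mul_one]

lemma uniformPartition_succ (a s : ℝ≥0) (n i : ℕ) :
    uniformPartition a s n (i + 1) = uniformPartition a s n i + s / n := by
  simp only [uniformPartition, Nat.cast_succ]
  ring

lemma uniformPartition_step (a s : ℝ≥0) (n i : ℕ) :
    (uniformPartition a s n (i + 1) : ℝ) - uniformPartition a s n i = s / n := by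
  rw [uniformPartition_succ]
  push_cast
  ring

lemma uniformPartition_mem_Icc (a s : ℝ≥0) {n i : ℕ} (hi : i ≤ n) :
    (uniformPartition a s n i : ℝ) ∈ Set.Icc (a : ℝ) (a + s) := by
  simp only [uniformPartition]
  push_cast
  have h1 : (i : ℝ) / n ≤ 1 := div_le_one_of_le₀ (by exact_mod_cast hi) (by positivity)
  have h2 : (0 : ℝ) ≤ i / n := by positivity
  constructor
  · nlinarith [s.coe_nonneg, mul_nonneg s.coe_nonneg h2]
  · nlinarith [mul_le_mul_of_nonneg_left h1 s.coe_nonneg]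

lemma uniformPartition_mul (a s : ℝ≥0) {n r : ℕ} (hr : 0 < r) (i : ℕ) :
    uniformPartition a s (n * r) (r * i) = uniformPartition a s n i := by
  have : (r : ℝ≥0) ≠ 0 := by exact_mod_cast hr.ne'
  simp only [uniformPartition]
  push_cast
  rw [mul_comm (n : ℝ≥0), mul_div_mul_left _ _ this]

lemma eventually_uniformPartition_mesh_le (a s : ℝ≥0) {δ : ℝ} (hδ : 0 < δ) :
    ∀ᶠ n in atTop, ∀ i < n, (uniformPartition a s n (i + 1) : ℝ) - uniformPartition a s n i ≤ δ := by
  have : Tendsto (fun n : ℕ => (s : ℝ) / n) atTop (𝓝 0) := tendsto_const_div_atTop_nhds_zero_nat _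
  filter_upwards [this.eventually (gt_mem_nhds hδ)] with n hn i _
  rw [uniformPartition_step]
  exact hn.le

/-- A continuous function varies by at most `ε` over the intervals of a fine uniform partition. -/
lemma eventually_uniformPartition_dist_le {f : ℝ → ℝ} (hf : Continuous f) (a s : ℝ≥0) {ε : ℝ}
    (hε : 0 < ε) : ∀ᶠ n in atTop, ∀ i < n, ∀ x ∈ Set.Icc (uniformPartition a s n i : ℝ)
      (uniformPartition a s n (i + 1)), |f (uniformPartition a s n i) - f x| ≤ ε := by
  have huc := isCompact_Icc.uniformContinuousOn_of_continuous
    (hf.continuousOn (s := Set.Icc (a : ℝ) (a + s)))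
  obtain ⟨δ, hδ, h⟩ := Metric.uniformContinuousOn_iff.1 huc ε hε
  filter_upwards [eventually_uniformPartition_mesh_le a s (half_pos hδ)] with n hn i hi x hx
  have h1 := uniformPartition_mem_Icc a s hi.le
  have h2 := uniformPartition_mem_Icc a s (Nat.succ_le_of_lt hi)
  have h3 := hn i hi
  refine (h _ h1 x ⟨h1.1.trans hx.1, hx.2.trans h2.2⟩ ?_).le
  rw [Real.dist_eq, abs_lt]
  constructor <;> linarith [hx.1, hx.2]

/-- Left-endpoint Riemann sums of a continuous function converge to its integral. -/
lemma tendsto_riemannSum_uniformPartition {f : ℝ → ℝ} (hf : Continuous f) (a s : ℝ≥0) :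
    Tendsto (fun n : ℕ => ∑ i ∈ range n, f (uniformPartition a s n i) *
      ((uniformPartition a s n (i + 1) : ℝ) - uniformPartition a s n i)) atTop
      (𝓝 (∫ x in (a : ℝ)..(a + s : ℝ≥0), f x)) := by
  rw [Metric.tendsto_atTop']
  intro ε hε
  have hpos : 0 < ε / (s + 1) := by positivity
  obtain ⟨N, hN⟩ := eventually_atTop.1 (eventually_uniformPartition_dist_le hf a s hpos)
  refine ⟨N, fun n hn => ?_⟩
  have hn0 : 0 < n := lt_of_le_of_lt N.zero_le hn
  have hp := isPartition_uniformPartition a s hn0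
  have hint : ∀ x y : ℝ, IntervalIntegrable f volume x y := fun x y => hf.intervalIntegrable x y
  have hsum := intervalIntegral.sum_integral_adjacent_intervals (f := f) (μ := volume)
    (a := fun i => (uniformPartition a s n i : ℝ)) (n := n) (fun i _ => hint _ _)
  rw [hp.2.1, hp.2.2] at hsum
  rw [← hsum, dist_eq_norm, ← sum_sub_distrib]
  have hterm : ∀ i ∈ range n, ‖f (uniformPartition a s n i) *
      ((uniformPartition a s n (i + 1) : ℝ) - uniformPartition a s n i) -
      ∫ x in (uniformPartition a s n i : ℝ)..(uniformPartition a s n (i + 1)), f x‖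
      ≤ ε / (s + 1) * (s / n) := by
    intro i hi
    have hle : (uniformPartition a s n i : ℝ) ≤ uniformPartition a s n (i + 1) :=
      hp.1 i.le_succ
    have h1 : f (uniformPartition a s n i) *
      ((uniformPartition a s n (i + 1) : ℝ) - uniformPartition a s n i) =
      ∫ x in (uniformPartition a s n i : ℝ)..(uniformPartition a s n (i + 1)),
        f (uniformPartition a s n i) := by
      rw [intervalIntegral.integral_const, smul_eq_mul, mul_comm]
    rw [h1, ← intervalIntegral.integral_sub (by simp) (hint _ _)]
    refine (intervalIntegral.norm_integral_le_of_norm_le_const (C := ε / (s + 1))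
      fun x hx => ?_).trans (le_of_eq ?_)
    · rw [Set.uIoc_of_le hle] at hx
      exact hN n hn.le i (mem_range.1 hi) x ⟨hx.1.le, hx.2⟩
    · rw [uniformPartition_step, abs_of_nonneg (by positivity)]
  refine (norm_sum_le_of_le _ hterm).trans_lt ?_
  have hn' : (n : ℝ) ≠ 0 := by exact_mod_cast hn0.ne'
  rw [sum_const, card_range, nsmul_eq_mul]
  calc (n : ℝ) * (ε / (s + 1) * (s / n)) = ε * (s / (s + 1)) := by field_simp
    _ < ε := mul_lt_of_lt_one_right hε (by rw [div_lt_one (by positivity)]; linarith)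

/-- Summation over a partition whose blocks have `r` elements each. -/
lemma sum_range_mul_div_mul_sub (c G : ℕ → ℝ) (n r : ℕ) :
    ∑ l ∈ range (n * r), c (l / r) * (G (l + 1) - G l) =
      ∑ i ∈ range n, c i * (G (r * (i + 1)) - G (r * i)) := by
  induction n with
  | zero => simp
  | succ n ih =>
    rw [Nat.succ_mul, sum_range_add, ih, sum_range_succ]
    congr 1
    have : ∀ j ∈ range r, c ((n * r + j) / r) * (G (n * r + j + 1) - G (n * r + j)) =
        c n * (G (n * r + (j + 1)) - G (n * r + j)) := by
      intro j hj
      have hj := mem_range.1 hj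
      rw [Nat.add_comm (n * r) j, Nat.add_mul_div_right _ _ (by omega), Nat.div_eq_of_lt hj,
        zero_add]
      congr 3
      omega
    rw [sum_congr rfl this, ← mul_sum, sum_range_sub (fun j => G (n * r + j))]
    congr 3 <;> ring

variable {Ω : Type*} {mΩ : MeasurableSpace Ω} {P : Measure Ω} {𝓕 : Filtration ℝ≥0 mΩ}
  {L : ℝ≥0 → Ω → ℝ}

lemma leftSum_uniformPartition_sub_refinement (f : ℝ → ℝ) (a s : ℝ≥0) {n r : ℕ} (hr : 0 < r) :
    (fun ω => leftSum f L n (uniformPartition a s n) ω -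
      leftSum f L (n * r) (uniformPartition a s (n * r)) ω) =
    incrementSum (fun l => f (uniformPartition a s n (l / r)) -
      f (uniformPartition a s (n * r) l)) L (uniformPartition a s (n * r)) (n * r) := by
  ext ω
  have := sum_range_mul_div_mul_sub (fun i => f (uniformPartition a s n i))
    (fun l => L (uniformPartition a s (n * r) l) ω) n r
  simp only [uniformPartition_mul a s hr] at this
  simp only [leftSum, incrementSum, sub_mul, sum_sub_distrib]
  rw [this]

variable [IsProbabilityMeasure P]

/-- Left sums along a uniform partition are close in `L²` to those along its refinements. -/
lemma IsLevyProcess.eventually_integral_sq_leftSum_sub_le (hL : IsLevyProcess P 𝓕 L)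
    (h1 : MemLp (L 1) 2 P) {f : ℝ → ℝ} (hf : Continuous f) (a s : ℝ≥0) {ε : ℝ} (hε : 0 < ε) :
    ∀ᶠ n in atTop, ∀ r, 0 < r → ∫ ω, (leftSum f L n (uniformPartition a s n) ω -
      leftSum f L (n * r) (uniformPartition a s (n * r)) ω) ^ 2 ∂P ≤ ε := by
  set v := variance (L 1) P with hv
  set m := ∫ ω, L 1 ω ∂P with hm
  have hv0 : 0 ≤ v := variance_nonneg _ _
  set B : ℝ := s * v + s ^ 2 * m ^ 2 with hB
  have hB0 : 0 ≤ B := by positivity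
  have hδ : 0 < √(ε / (B + 1)) := Real.sqrt_pos.2 (by positivity)
  set δ := √(ε / (B + 1)) with hδ'
  filter_upwards [eventually_uniformPartition_dist_le hf a s hδ, eventually_gt_atTop 0]
    with n hn hn0 r hr
  have hsub := leftSum_uniformPartition_sub_refinement (L := L) f a s (n := n) hr
  set c : ℕ → ℝ := fun l => f (uniformPartition a s n (l / r)) -
      f (uniformPartition a s (n * r) l) with hc
  have hmono := uniformPartition_monotone a s (n * r)
  have hc' : ∀ l ∈ range (n * r), |c l| ≤ δ := by
    intro l hl
    have hl := mem_range.1 hl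
    refine hn (l / r) ((Nat.div_lt_iff_lt_mul hr).2 hl) _ ⟨?_, ?_⟩
    · rw [← uniformPartition_mul a s hr]
      exact hmono (Nat.mul_div_le l r)
    · rw [← uniformPartition_mul a s hr (l / r + 1)]
      exact hmono (Nat.lt_mul_div_succ l hr).le
  have hmem := hL.memLp_incrementSum h1 c (uniformPartition a s (n * r)) (n * r)
  have hvar := variance_eq_sub hmem
  rw [hL.variance_incrementSum h1 c hmono, hL.integral_incrementSum h1 c hmono] at hvar
  simp only [Pi.pow_apply] at hvar
  simp_rw [fun ω => congrFun hsub ω]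
  have hnr : ((n * r : ℕ) : ℝ) ≠ 0 := by exact_mod_cast (Nat.mul_pos hn0 hr).ne'
  have hs1 : ∑ i ∈ range (n * r), δ ^ 2 * ((s : ℝ) / (n * r : ℕ)) = δ ^ 2 * s := by
    rw [sum_const, card_range, nsmul_eq_mul]; field_simp
  have hs2 : ∑ i ∈ range (n * r), δ * ((s : ℝ) / (n * r : ℕ)) = δ * s := by
    rw [sum_const, card_range, nsmul_eq_mul]; field_simp
  have hq : ∑ i ∈ range (n * r), c i ^ 2 * ((uniformPartition a s (n * r) (i + 1) : ℝ) -
      uniformPartition a s (n * r) i) ≤ δ ^ 2 * s := by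
    rw [← hs1]
    refine sum_le_sum fun i hi => ?_
    rw [uniformPartition_step]
    refine mul_le_mul_of_nonneg_right ?_ (by positivity)
    rw [← sq_abs]
    exact pow_le_pow_left₀ (abs_nonneg _) (hc' i hi) 2
  have hl : |∑ i ∈ range (n * r), c i * ((uniformPartition a s (n * r) (i + 1) : ℝ) -
      uniformPartition a s (n * r) i)| ≤ δ * s := by
    rw [← hs2]
    refine (abs_sum_le_sum_abs _ _).trans (sum_le_sum fun i hi => ?_)
    rw [uniformPartition_step, abs_mul, abs_of_nonneg (a := (s : ℝ) / _) (by positivity)]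
    exact mul_le_mul_of_nonneg_right (hc' i hi) (by positivity)
  have hl2 := pow_le_pow_left₀ (abs_nonneg _) hl 2
  rw [sq_abs] at hl2
  have hδ2 : δ ^ 2 * (B + 1) = ε := by
    rw [hδ', Real.sq_sqrt (by positivity)]
    field_simp
  have e1 := mul_le_mul_of_nonneg_right hq hv0
  have e2 := mul_le_mul_of_nonneg_right hl2 (sq_nonneg m)
  rw [← mul_pow] at e2
  nlinarith [sq_nonneg δ]

namespace IsStochIntegral

variable {f : ℝ → ℝ} {a s : ℝ≥0} {J : Ω → ℝ}

lemma tendstoInMeasure_uniformPartition {Ω : Type*} {mΩ : MeasurableSpace Ω} {P : Measure Ω}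
    {L : ℝ≥0 → Ω → ℝ} {J : Ω → ℝ} (hJ : IsStochIntegral P f L a (a + s) J) :
    TendstoInMeasure P
      (fun k => leftSum f L (k + 1) (uniformPartition a s (k + 1))) atTop J := by
  refine hJ.2 _ _ (fun k => isPartition_uniformPartition a s k.succ_pos) fun δ hδ => ?_
  exact (tendsto_add_atTop_nat 1).eventually (eventually_uniformPartition_mesh_le a s hδ)

/-- Isometry and mean of the stochastic integral of a continuous function. -/
lemma moments (hL : IsLevyProcess P 𝓕 L) (h1 : MemLp (L 1) 2 P) (hf : Continuous f)
    (hJ : IsStochIntegral P f L a (a + s) J) :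
    MemLp J 2 P ∧ ∫ ω, J ω ∂P = (∫ x in (a : ℝ)..(a + s : ℝ≥0), f x) * ∫ ω, L 1 ω ∂P ∧
      variance J P = (∫ x in (a : ℝ)..(a + s : ℝ≥0), f x ^ 2) * variance (L 1) P := by
  set S : ℕ → Ω → ℝ := fun k => leftSum f L (k + 1) (uniformPartition a s (k + 1)) with hS
  have hSm : ∀ n, MemLp (leftSum f L n (uniformPartition a s n)) 2 P :=
    fun n => hL.memLp_incrementSum h1 _ _ _
  have hC : Tendsto (fun p : ℕ × ℕ => ∫ ω, (S p.1 ω - S p.2 ω) ^ 2 ∂P) atTop (𝓝 0) := by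
    rw [Metric.tendsto_atTop]
    intro ε hε
    obtain ⟨K, hK⟩ := eventually_atTop.1
      (hL.eventually_integral_sq_leftSum_sub_le h1 hf a s (show 0 < ε / 8 by positivity))
    refine ⟨(K, K), fun p hp => ?_⟩
    have e1 := hK (p.1 + 1) (Nat.le_succ_of_le hp.1) (p.2 + 1) p.2.succ_pos
    have e2 := hK (p.2 + 1) (Nat.le_succ_of_le hp.2) (p.1 + 1) p.1.succ_pos
    -- compare both sums with the one along a common refinement
    rw [mul_comm (p.2 + 1) (p.1 + 1)] at e2
    set T := leftSum f L ((p.1 + 1) * (p.2 + 1))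
      (uniformPartition a s ((p.1 + 1) * (p.2 + 1))) with hT
    have i1 : Integrable (fun ω => (S p.1 ω - T ω) ^ 2) P := ((hSm _).sub (hSm _)).integrable_sq
    have i2 : Integrable (fun ω => (S p.2 ω - T ω) ^ 2) P := ((hSm _).sub (hSm _)).integrable_sq
    have hle : ∫ ω, (S p.1 ω - S p.2 ω) ^ 2 ∂P ≤
        ∫ ω, (2 * (S p.1 ω - T ω) ^ 2 + 2 * (S p.2 ω - T ω) ^ 2) ∂P := by
      refine integral_mono ((hSm _).sub (hSm _)).integrable_sq
        ((i1.const_mul 2).add (i2.const_mul 2)) fun ω => ?_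
      simp only
      nlinarith [sq_nonneg (S p.1 ω - T ω + (S p.2 ω - T ω))]
    rw [integral_add (i1.const_mul 2) (i2.const_mul 2), integral_const_mul,
      integral_const_mul] at hle
    rw [Real.dist_eq, sub_zero, abs_of_nonneg (integral_nonneg fun ω => sq_nonneg _)]
    simp only [hS] at hle e1 e2 ⊢
    linarith
  obtain ⟨hJ2, hmean, hvar⟩ := moments_of_tendstoInMeasure_of_cauchy (fun k => hSm (k + 1)) hC
    hJ.tendstoInMeasure_uniformPartition
  refine ⟨hJ2, tendsto_nhds_unique hmean ?_, tendsto_nhds_unique hvar ?_⟩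
  · simp_rw [leftSum_eq_incrementSum,
      hL.integral_incrementSum h1 _ (uniformPartition_monotone _ _ _)]
    exact ((tendsto_riemannSum_uniformPartition hf a s).comp (tendsto_add_atTop_nat 1)).mul_const _
  · simp_rw [leftSum_eq_incrementSum,
      hL.variance_incrementSum h1 _ (uniformPartition_monotone _ _ _)]
    exact ((tendsto_riemannSum_uniformPartition (hf.pow 2) a s).comp
      (tendsto_add_atTop_nat 1)).mul_const _

/-- On an event of the past up to time `a`, the characteristic function of the stochastic integral
is a limit of products of characteristic functions of increments. -/
lemma tendsto_prod_charFun (hL : IsLevyProcess P 𝓕 L)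
    (hJ : IsStochIntegral P f L a (a + s) J) {A : Set Ω} (hA : MeasurableSet[𝓕 a] A) (u : ℝ) :
    Tendsto (fun k : ℕ => (P.real A : ℂ) * ∏ i ∈ range (k + 1),
      charFun (P.map (L (s / (k + 1 : ℕ)))) (u * f (uniformPartition a s (k + 1) i))) atTop
      (𝓝 (∫ ω in A, Complex.exp (u * J ω * Complex.I) ∂P)) := by
  have hmeas : ∀ k, Measurable (leftSum f L (k + 1) (uniformPartition a s (k + 1))) := fun k =>
    (hL.measurable_incrementSum (fun i => f (uniformPartition a s (k + 1) i))
      (uniformPartition_monotone a s (k + 1)) (k + 1)).mono (𝓕.le _) le_rfl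
  have := tendsto_integral_cexp_of_tendstoInMeasure (Q := P.restrict A)
    (fun k => (hmeas k).aemeasurable)
    (TendstoInMeasure.restrict_measure hJ.tendstoInMeasure_uniformPartition A) u
  refine this.congr fun k => ?_
  rw [leftSum_eq_incrementSum, hL.setIntegral_cexp_incrementSum _ (uniformPartition_monotone _ _ _)
    _ (by rwa [uniformPartition_zero])]
  congr 1
  refine prod_congr rfl fun i _ => ?_
  rw [uniformPartition_succ, add_tsub_cancel_left]

/-- The stochastic integral over `[a, a + s]` is independent of the past up to time `a`. -/
lemma indep (hL : IsLevyProcess P 𝓕 L) (hJ : IsStochIntegral P f L a (a + s) J)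
    (hJm : Measurable J) : Indep (MeasurableSpace.comap J inferInstance) (𝓕 a) P := by
  refine indep_comap_of_setIntegral_cexp hJm fun A hA u => ?_
  have h2 := hJ.tendsto_prod_charFun hL (MeasurableSet.univ (m := 𝓕 a)) u
  simp only [probReal_univ, Complex.ofReal_one, one_mul, Measure.restrict_univ] at h2
  exact tendsto_nhds_unique (hJ.tendsto_prod_charFun hL hA u) (h2.const_mul _)

/-- Stationarity of the increments: integrals of proportional translates of a function over
intervals of equal length have proportional laws. -/
lemma identDistrib (hL : IsLevyProcess P 𝓕 L) {a' : ℝ≥0} {J' : Ω → ℝ} {C : ℝ}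
    (hJ : IsStochIntegral P f L a (a + s) J) (hJ' : IsStochIntegral P f L a' (a' + s) J')
    (hC : ∀ x : ℝ, f (a + x) = C * f (a' + x)) :
    IdentDistrib J (fun ω => C * J' ω) P P := by
  have hCJ' : AEMeasurable (fun ω => C * J' ω) P := hJ'.1.const_mul C
  refine ⟨hJ.1, hCJ', ?_⟩
  have := Measure.isFiniteMeasure_map P J
  have := Measure.isFiniteMeasure_map P fun ω => C * J' ω
  refine Measure.ext_of_charFun (funext fun u => ?_)
  have hc : Continuous fun x : ℝ => Complex.exp (u * x * Complex.I) := by fun_prop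
  simp only [charFun_apply_real]
  rw [integral_map hJ.1 hc.aestronglyMeasurable, integral_map hCJ' hc.aestronglyMeasurable]
  have h1 := hJ.tendsto_prod_charFun hL (MeasurableSet.univ (m := 𝓕 a)) u
  have h2 := hJ'.tendsto_prod_charFun hL (MeasurableSet.univ (m := 𝓕 a')) (u * C)
  simp only [probReal_univ, Complex.ofReal_one, one_mul, Measure.restrict_univ] at h1 h2
  push_cast at h2 ⊢
  simp_rw [← mul_assoc]
  refine tendsto_nhds_unique h1 (h2.congr fun k => ?_)
  push_cast
  refine prod_congr rfl fun i _ => ?_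
  simp only [uniformPartition]
  push_cast
  rw [hC, ← mul_assoc]

/-- Additivity in the interval of integration. -/
lemma sub {Ω : Type*} {mΩ : MeasurableSpace Ω} {P : Measure Ω}
    {L : ℝ≥0 → Ω → ℝ} {J₀ J₁ : Ω → ℝ} {b : ℝ≥0} (h₀ : IsStochIntegral P f L 0 a J₀)
    (h₁ : IsStochIntegral P f L 0 b J₁) : IsStochIntegral P f L a b (fun ω => J₁ ω - J₀ ω) := by
  refine ⟨h₁.1.sub h₀.1, fun N π hπ hmesh => ?_⟩
  set τ : ℕ → ℕ → ℝ≥0 := fun k => uniformPartition 0 a (k + 1) with hτ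
  have hτp : ∀ k, IsPartition 0 a (k + 1) (τ k) := fun k => by
    simpa using isPartition_uniformPartition 0 a k.succ_pos
  -- `ρ k` runs through the uniform partition of `[0, a]` and then through `π k`
  set ρ : ℕ → ℕ → ℝ≥0 := fun k i => if i ≤ k + 1 then τ k i else π k (i - (k + 1)) with hρ
  have hρ1 : ∀ k i, i ≤ k + 1 → ρ k i = τ k i := fun k i hi => if_pos hi
  have hρ2 : ∀ k i, ρ k (k + 1 + i) = π k i := by
    intro k i
    rcases Nat.eq_zero_or_pos i with rfl | hi
    · rw [add_zero, hρ1 k _ le_rfl, (hτp k).2.2, (hπ k).2.1]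
    · simp only [hρ]
      rw [if_neg (by omega), Nat.add_sub_cancel_left]
  have hρp : ∀ k, IsPartition 0 b (k + 1 + N k) (ρ k) := by
    intro k
    refine ⟨monotone_nat_of_le_succ fun i => ?_, ?_, ?_⟩
    · rcases lt_or_ge i (k + 1) with hi | hi
      · rw [hρ1 k i hi.le, hρ1 k (i + 1) hi]
        exact (hτp k).1 i.le_succ
      · obtain ⟨j, rfl⟩ := Nat.exists_eq_add_of_le hi
        rw [hρ2, add_assoc, hρ2]
        exact (hπ k).1 j.le_succ
    · rw [hρ1 k 0 (Nat.zero_le _), (hτp k).2.1]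
    · rw [hρ2, (hπ k).2.2]
  have hτmesh : ∀ δ : ℝ, 0 < δ → ∀ᶠ k in atTop, ∀ i < k + 1,
      (τ k (i + 1) : ℝ) - τ k i ≤ δ := fun δ hδ =>
    (tendsto_add_atTop_nat 1).eventually (eventually_uniformPartition_mesh_le 0 a hδ)
  have hlim₀ := h₀.2 (fun k => k + 1) τ hτp hτmesh
  have hlim₁ := h₁.2 (fun k => k + 1 + N k) ρ hρp fun δ hδ => by
    filter_upwards [hτmesh δ hδ, hmesh δ hδ] with k hk1 hk2 i hi
    rcases lt_or_ge i (k + 1) with h | h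
    · rw [hρ1 k i h.le, hρ1 k (i + 1) h]
      exact hk1 i h
    · obtain ⟨j, rfl⟩ := Nat.exists_eq_add_of_le h
      rw [hρ2, add_assoc, hρ2]
      exact hk2 j (by omega)
  have hsub := TendstoInMeasure.real_sub hlim₁ hlim₀
  refine hsub.congr_left fun k => ae_of_all _ fun ω => ?_
  simp only [leftSum]
  rw [sum_range_add, sub_eq_iff_eq_add']
  congr 1
  · refine sum_congr rfl fun i hi => ?_
    have hi := mem_range.1 hi
    rw [hρ1 k i hi.le, hρ1 k (i + 1) hi]
  · refine sum_congr rfl fun i _ => ?_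
    rw [hρ2, add_assoc, hρ2]

end IsStochIntegral

end StochIntegral

/-! ### The completed past of a Lévy process together with an independent variable -/

section EnlargedFiltration

variable {Ω : Type*} {mΩ : MeasurableSpace Ω} {P : Measure Ω} {𝓕 : Filtration ℝ≥0 mΩ}
  {L : ℝ≥0 → Ω → ℝ} {X : Ω → ℝ}

lemma indep_sup_of_indep_sup {a b c : MeasurableSpace Ω} [IsProbabilityMeasure P] (ha : a ≤ mΩ)
    (hb : b ≤ mΩ) (hc : c ≤ mΩ) (h1 : Indep a (b ⊔ c) P) (h2 : Indep b c P) :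
    Indep c (a ⊔ b) P := by
  have hgen : a ⊔ b = MeasurableSpace.generateFrom
      {s | ∃ A B, MeasurableSet[a] A ∧ MeasurableSet[b] B ∧ A ∩ B = s} := by
    refine le_antisymm (sup_le ?_ ?_) (MeasurableSpace.generateFrom_le ?_)
    · exact fun A hA => MeasurableSpace.measurableSet_generateFrom
        ⟨A, Set.univ, hA, MeasurableSet.univ, Set.inter_univ A⟩
    · exact fun B hB => MeasurableSpace.measurableSet_generateFrom
        ⟨Set.univ, B, MeasurableSet.univ, hB, Set.univ_inter B⟩
    · rintro _ ⟨A, B, hA, hB, rfl⟩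
      exact MeasurableSet.inter ((le_sup_left : a ≤ a ⊔ b) _ hA) ((le_sup_right : b ≤ a ⊔ b) _ hB)
  refine IndepSets.indep hc (sup_le ha hb) (@MeasurableSpace.isPiSystem_measurableSet _ c) ?_
    (@MeasurableSpace.generateFrom_measurableSet _ c).symm hgen ?_
  · rintro _ ⟨A, B, hA, hB, rfl⟩ _ ⟨A', B', hA', hB', rfl⟩ -
    exact ⟨A ∩ A', B ∩ B', hA.inter hA', hB.inter hB', by
      rw [Set.inter_inter_inter_comm]⟩
  · rw [IndepSets_iff]
    rintro C _ hC ⟨A, B, hA, hB, rfl⟩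
    rw [Indep_iff] at h1 h2
    have e1 := h1 A (B ∩ C) hA
      (MeasurableSet.inter ((le_sup_left : b ≤ b ⊔ c) _ hB) ((le_sup_right : c ≤ b ⊔ c) _ hC))
    have e2 := h1 A B hA ((le_sup_left : b ≤ b ⊔ c) _ hB)
    have e3 := h2 B C hB hC
    rw [Set.inter_comm, Set.inter_assoc, e1, e3, e2]
    ring

/-- The filtration generated by `X` and by the path of `L` up to time `t`, completed by the
events that differ from these by a null set. -/
def completedPast (P : Measure Ω) (L : ℝ≥0 → Ω → ℝ) (X : Ω → ℝ) : Filtration ℝ≥0 mΩ where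
  seq t := eventuallyMeasurableSpace (MeasurableSpace.comap X inferInstance ⊔
    ⨆ r ≤ t, MeasurableSpace.comap (L r) inferInstance) (ae P) ⊓ mΩ
  mono' := by
    intro s t hst A hA
    obtain ⟨⟨B, hB, hAB⟩, hA2⟩ := MeasurableSpace.measurableSet_inf.1 hA
    refine MeasurableSpace.measurableSet_inf.2 ⟨⟨B, ?_, hAB⟩, hA2⟩
    have hle : ⨆ r ≤ s, MeasurableSpace.comap (L r) inferInstance ≤
        ⨆ r ≤ t, MeasurableSpace.comap (L r) inferInstance :=
      biSup_mono fun r hr => hr.trans hst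
    exact (sup_le_sup_left hle _ : _ ≤ _) B hB
  le' _ := inf_le_right

/-- Measurability with respect to the completed past only depends on the almost sure class. -/
lemma measurable_completedPast_of_ae_eq {t : ℝ≥0} {U V : Ω → ℝ} (hU : Measurable U)
    (hV : Measurable[completedPast P L X t] V) (hUV : U =ᵐ[P] V) :
    Measurable[completedPast P L X t] U := by
  intro B hB
  have h1 := (MeasurableSpace.measurableSet_inf.1 (hV hB)).1
  exact MeasurableSpace.measurableSet_inf.2 ⟨EventuallyMeasurableSet.congr h1
    (hUV.preimage B), hU hB⟩

lemma measurable_completedPast_left (hX : Measurable X) (t : ℝ≥0) :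
    Measurable[completedPast P L X t] X := by
  intro B hB
  refine MeasurableSpace.measurableSet_inf.2 ⟨le_eventuallyMeasurableSpace _ ?_, hX hB⟩
  exact (le_sup_left : MeasurableSpace.comap X inferInstance ≤ _) _ ⟨B, hB, rfl⟩

/-- Enlarging the filtration by an independent variable and by null sets preserves the Lévy
property. -/
lemma IsLevyProcess.completedPast [IsProbabilityMeasure P] (hL : IsLevyProcess P 𝓕 L)
    (hX : Measurable X) (hXL : IndepFun X (fun ω t => L t ω) P) :
    IsLevyProcess P (completedPast P L X) L where
  adapted t := by
    intro B hB
    refine MeasurableSpace.measurableSet_inf.2 ⟨le_eventuallyMeasurableSpace _ ?_,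
      hL.measurable t hB⟩
    refine (le_sup_of_le_right (le_iSup₂ (f := fun r (_ : r ≤ t) =>
      MeasurableSpace.comap (L r) inferInstance) t le_rfl) :
      MeasurableSpace.comap (L t) inferInstance ≤ _) _ ⟨B, hB, rfl⟩
  zero := hL.zero
  indep_increments s t hst := by
    have hinc : MeasurableSpace.comap (fun ω => L t ω - L s ω) inferInstance ≤ mΩ :=
      ((hL.measurable t).sub (hL.measurable s)).comap_le
    set b : MeasurableSpace Ω := ⨆ r ≤ s, MeasurableSpace.comap (L r) inferInstance with hb
    set c : MeasurableSpace Ω :=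
      MeasurableSpace.comap (fun ω => L t ω - L s ω) inferInstance with hc
    have hbF : b ≤ 𝓕 s := iSup₂_le fun r hr =>
      (hL.adapted r).comap_le.trans (𝓕.mono hr)
    have hbpath : b ≤ MeasurableSpace.comap (fun ω t => L t ω) inferInstance := by
      refine iSup₂_le fun r _ => ?_
      rintro _ ⟨B, hB, rfl⟩
      exact ⟨(fun p : ℝ≥0 → ℝ => p r) ⁻¹' B, measurable_pi_apply r hB, rfl⟩
    have hcpath : c ≤ MeasurableSpace.comap (fun ω t => L t ω) inferInstance := by
      rintro _ ⟨B, hB, rfl⟩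
      exact ⟨(fun p : ℝ≥0 → ℝ => p t - p s) ⁻¹' B,
        ((measurable_pi_apply t).sub (measurable_pi_apply s)) hB, rfl⟩
    have key := indep_sup_of_indep_sup hX.comap_le (hbF.trans (𝓕.le s)) hinc
      (indep_of_indep_of_le_right hXL (sup_le hbpath hcpath))
      (indep_of_indep_of_le_right (hL.indep_increments s t hst) hbF).symm
    rw [Indep_iff] at key ⊢
    intro C A hC hA
    obtain ⟨⟨B, hB, hAB⟩, -⟩ := MeasurableSpace.measurableSet_inf.1 hA
    rw [measure_congr ((ae_eq_refl C).inter hAB), measure_congr hAB]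
    exact key C B hC hB
  stationary_increments := hL.stationary_increments
  continuous_in_probability := hL.continuous_in_probability
  cadlag := hL.cadlag

/-- An affine combination of `X` and of the stochastic integral over `[0, b]` belongs to the
completed past up to time `b`. -/
lemma IsStochIntegral.measurable_completedPast [IsProbabilityMeasure P]
    (hL : IsLevyProcess P 𝓕 L) (hX : Measurable X) (hXL : IndepFun X (fun ω t => L t ω) P)
    {f : ℝ → ℝ} {b : ℝ≥0} {J U : Ω → ℝ} (hJ : IsStochIntegral P f L 0 b J) {α β : ℝ}
    (hU : Measurable U) (hUJ : ∀ᵐ ω ∂P, U ω = α * X ω + β * J ω) :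
    Measurable[_root_.completedPast P L X b] U := by
  have hL' := hL.completedPast hX hXL
  have hlim := IsStochIntegral.tendstoInMeasure_uniformPartition (a := 0) (s := b)
    (by rwa [zero_add])
  obtain ⟨ns, -, hns⟩ := hlim.exists_seq_tendsto_ae
  have hSm : ∀ n, Measurable[_root_.completedPast P L X b]
      (leftSum f L (n + 1) (uniformPartition 0 b (n + 1))) := by
    intro n
    have := hL'.measurable_incrementSum (fun i => f (uniformPartition 0 b (n + 1) i))
      (uniformPartition_monotone 0 b (n + 1)) (n + 1)
    rwa [(isPartition_uniformPartition 0 b n.succ_pos).2.2, zero_add] at this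
  have hgm : ∀ k, StronglyMeasurable[_root_.completedPast P L X b] (fun ω => α * X ω +
      β * leftSum f L (ns k + 1) (uniformPartition 0 b (ns k + 1)) ω) := fun k =>
    Measurable.stronglyMeasurable
      (((measurable_completedPast_left hX b).const_mul α).add ((hSm (ns k)).const_mul β))
  refine measurable_completedPast_of_ae_eq hU
    (@StronglyMeasurable.limUnder _ _ _ (_root_.completedPast P L X b) _ _ atTop _ _ _ _ hgm).measurable ?_
  filter_upwards [hns, hUJ] with ω h1 h2
  rw [h2, eq_comm]
  exact ((h1.const_mul β).const_add (α * X ω)).limUnder_eq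

end EnlargedFiltration

/-! ### Averages of deterministic sequences -/

section Averages

lemma tendsto_zero_of_le_mul_add {y ε : ℕ → ℝ} {a : ℝ} (ha0 : 0 ≤ a) (ha1 : a < 1)
    (h : ∀ n, |y (n + 1)| ≤ a * |y n| + ε n) (hε : Tendsto ε atTop (𝓝 0)) :
    Tendsto y atTop (𝓝 0) := by
  rw [Metric.tendsto_atTop']
  intro δ hδ
  have hpos : 0 < δ / 2 * (1 - a) := by have := sub_pos.2 ha1; positivity
  obtain ⟨N, hN⟩ := eventually_atTop.1 (hε.eventually (gt_mem_nhds hpos))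
  have hk : ∀ k, |y (N + k)| ≤ a ^ k * |y N| + δ / 2 := by
    intro k
    induction k with
    | zero => simp; positivity
    | succ k ih =>
      have h1 := h (N + k)
      have h2 := hN (N + k) (Nat.le_add_right _ _)
      have h3 := mul_le_mul_of_nonneg_left ih ha0
      rw [← add_assoc, pow_succ]
      nlinarith
  have hpow : Tendsto (fun k => a ^ k * |y N|) atTop (𝓝 0) := by
    simpa using (tendsto_pow_atTop_nhds_zero_of_lt_one ha0 ha1).mul_const |y N|
  obtain ⟨K, hK⟩ := eventually_atTop.1 (hpow.eventually (gt_mem_nhds (half_pos hδ)))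
  refine ⟨N + K, fun n hn => ?_⟩
  obtain ⟨k, rfl⟩ := Nat.exists_eq_add_of_le (show N ≤ n by omega)
  have h1 := hk k
  have h2 := hK k (by omega)
  rw [Real.dist_eq, sub_zero]
  linarith

/-- If `s_{i+1} = a s_i + r_i` with `0 ≤ a < 1` and the averages of `r` converge to `ρ`, then the
averages of `s` converge to the fixed point `ρ / (1 - a)`. -/
lemma tendsto_average_of_recursion {s r : ℕ → ℝ} {a ρ : ℝ} (ha0 : 0 ≤ a) (ha1 : a < 1)
    (hs : ∀ i, s (i + 1) = a * s i + r i)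
    (hr : Tendsto (fun n : ℕ => (∑ i ∈ range n, r i) / n) atTop (𝓝 ρ)) :
    Tendsto (fun n : ℕ => (∑ i ∈ range n, s i) / n) atTop (𝓝 (ρ / (1 - a))) := by
  set l := ρ / (1 - a) with hl
  have h1a : 1 - a ≠ 0 := (sub_pos.2 ha1).ne'
  have hsum : ∀ n, ∑ i ∈ range (n + 1), s i =
      s 0 + a * ∑ i ∈ range n, s i + ∑ i ∈ range n, r i := by
    intro n
    rw [sum_range_succ', sum_congr rfl fun i _ => hs i, sum_add_distrib, ← mul_sum]
    ring
  have hmul : ∀ (u : ℕ → ℝ) (n : ℕ), (n : ℝ) * ((∑ i ∈ range n, u i) / n) = ∑ i ∈ range n, u i := by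
    intro u n
    rcases Nat.eq_zero_or_pos n with rfl | hn
    · simp
    · exact mul_div_cancel₀ _ (by exact_mod_cast hn.ne')
  have hratio : Tendsto (fun n : ℕ => (n : ℝ) / (n + 1)) atTop (𝓝 1) :=
    tendsto_natCast_div_add_atTop 1
  have hε : Tendsto (fun n : ℕ => s 0 / ((n : ℝ) + 1) + a * l * (n / (n + 1)) +
      (∑ i ∈ range n, r i) / n * (n / (n + 1)) - l) atTop (𝓝 0) := by
    have h0 : Tendsto (fun n : ℕ => s 0 / ((n : ℝ) + 1)) atTop (𝓝 0) := by
      have := (tendsto_const_div_atTop_nhds_zero_nat (s 0)).comp (tendsto_add_atTop_nat 1)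
      simpa [Function.comp_def] using this
    have := ((h0.add (hratio.const_mul (a * l))).add (hr.mul hratio)).sub_const l
    convert this using 2
    rw [hl]
    field_simp
    ring
  have hε' := hε.abs
  rw [abs_zero] at hε'
  have hmain := tendsto_zero_of_le_mul_add (y := fun n : ℕ => (∑ i ∈ range n, s i) / n - l)
    ha0 ha1 (fun n => ?_) hε'
  · simpa using hmain.add_const l
  · have hn : (0 : ℝ) < n + 1 := by positivity
    have hstep : (∑ i ∈ range (n + 1), s i) / ((n + 1 : ℕ) : ℝ) - l =
        a * (n / (n + 1)) * ((∑ i ∈ range n, s i) / n - l) +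
        (s 0 / ((n : ℝ) + 1) + a * l * (n / (n + 1)) +
          (∑ i ∈ range n, r i) / n * (n / (n + 1)) - l) := by
      have e1 := hmul s n
      have e2 := hmul r n
      generalize (∑ i ∈ range n, s i) / (n : ℝ) = A at e1 ⊢
      generalize (∑ i ∈ range n, r i) / (n : ℝ) = B at e2 ⊢
      rw [hsum, ← e1, ← e2]
      push_cast
      field_simp
      ring
    rw [hstep]
    refine (abs_add_le _ _).trans (add_le_add_left ?_ _)
    rw [abs_mul, abs_of_nonneg (by positivity)]
    refine mul_le_mul_of_nonneg_right (mul_le_of_le_one_right ha0 ?_) (abs_nonneg _)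
    exact div_le_one_of_le₀ (by linarith) hn.le

/-- Kronecker's lemma: convergence of `∑ w_i / (i + 1)` forces the averages of `w` to vanish. -/
lemma tendsto_average_zero_of_tendsto_sum_div {w : ℕ → ℝ} {t : ℝ}
    (h : Tendsto (fun n => ∑ i ∈ range n, w i / ((i : ℝ) + 1)) atTop (𝓝 t)) :
    Tendsto (fun n : ℕ => (∑ i ∈ range n, w i) / n) atTop (𝓝 0) := by
  set T : ℕ → ℝ := fun n => ∑ i ∈ range n, w i / ((i : ℝ) + 1) with hT
  have habel : ∀ n : ℕ, ∑ i ∈ range n, w i = n * T n - ∑ i ∈ range n, T i := by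
    intro n
    induction n with
    | zero => simp
    | succ n ih =>
      have : T (n + 1) = T n + w n / ((n : ℝ) + 1) := sum_range_succ _ _
      rw [sum_range_succ, ih, sum_range_succ, this]
      push_cast
      field_simp
      ring
  have := h.sub h.cesaro
  rw [sub_self] at this
  refine this.congr' ?_
  filter_upwards [eventually_gt_atTop 0] with n hn
  have hn' : (n : ℝ) ≠ 0 := by exact_mod_cast hn.ne'
  rw [habel]
  field_simp

lemma tendsto_average_shift {u : ℕ → ℝ} {l : ℝ} (h : ℕ)
    (hu : Tendsto (fun n : ℕ => (∑ i ∈ range n, u i) / n) atTop (𝓝 l)) :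
    Tendsto (fun n : ℕ => (∑ i ∈ range n, u (i + h)) / n) atTop (𝓝 l) := by
  have h1 := (hu.comp (tendsto_add_atTop_nat h))
  have h2 : Tendsto (fun n : ℕ => ((n : ℝ) + h) / n) atTop (𝓝 1) := by
    have := (tendsto_const_div_atTop_nhds_zero_nat (h : ℝ)).const_add 1
    rw [add_zero] at this
    refine this.congr' ?_
    filter_upwards [eventually_gt_atTop 0] with n hn
    have hn' : (n : ℝ) ≠ 0 := by exact_mod_cast hn.ne'
    field_simp
  have h3 := (h1.mul h2).sub (tendsto_const_div_atTop_nhds_zero_nat (∑ i ∈ range h, u i))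
  rw [mul_one, sub_zero] at h3
  refine h3.congr' ?_
  filter_upwards [eventually_gt_atTop 0] with n hn
  have hn' : (0 : ℝ) < n := by exact_mod_cast hn
  have hsum : ∑ i ∈ range (n + h), u i = ∑ i ∈ range h, u i + ∑ i ∈ range n, u (i + h) := by
    rw [add_comm n h, sum_range_add]
    simp_rw [add_comm h]
  simp only [Function.comp_apply]
  rw [hsum]
  push_cast
  field_simp
  ring

lemma tendsto_average_Icc {u : ℕ → ℝ} {l : ℝ} (h : ℕ)
    (hu : Tendsto (fun n : ℕ => (∑ i ∈ range n, u i) / n) atTop (𝓝 l)) :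
    Tendsto (fun n : ℕ => (1 / (n : ℝ)) * ∑ i ∈ Icc 1 (n - h), u i) atTop (𝓝 l) := by
  rw [← tendsto_add_atTop_iff_nat h]
  have h2 := (tendsto_average_shift 1 hu).mul (tendsto_natCast_div_add_atTop (h : ℝ))
  rw [mul_one] at h2
  refine h2.congr' ?_
  filter_upwards [eventually_gt_atTop 0] with n hn
  have hn' : (0 : ℝ) < n := by exact_mod_cast hn
  have hsum : ∑ i ∈ Icc 1 n, u i = ∑ i ∈ range n, u (i + 1) := by
    rw [range_eq_Ico, sum_Ico_add' u 0 n 1]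
    rfl
  rw [Nat.add_sub_cancel, hsum]
  push_cast
  field_simp

variable {x : ℕ → ℝ} {m : ℝ}

lemma tendsto_sampleMean (hx : Tendsto (fun n : ℕ => (∑ i ∈ range n, x i) / n) atTop (𝓝 m)) :
    Tendsto (sampleMean x) atTop (𝓝 m) :=
  tendsto_average_Icc 0 hx

lemma tendsto_sampleAutocov (hx : Tendsto (fun n : ℕ => (∑ i ∈ range n, x i) / n) atTop (𝓝 m))
    {h : ℕ} {c : ℝ}
    (hc : Tendsto (fun n : ℕ => (∑ i ∈ range n, x (i + h) * x i) / n) atTop (𝓝 (m ^ 2 + c))) :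
    Tendsto (fun n => sampleAutocov x n h) atTop (𝓝 c) := by
  have hm := tendsto_sampleMean hx
  have h1 := tendsto_average_Icc h hc
  have h2 := tendsto_average_Icc h (tendsto_average_shift h hx)
  have h3 := tendsto_average_Icc h hx
  have h4 : Tendsto (fun n : ℕ => (1 / (n : ℝ)) * ∑ i ∈ Icc 1 (n - h), (1 : ℝ)) atTop (𝓝 1) := by
    refine tendsto_average_Icc (u := fun _ => 1) h (tendsto_const_nhds.congr' ?_)
    filter_upwards [eventually_gt_atTop 0] with n hn
    have hn' : (n : ℝ) ≠ 0 := by exact_mod_cast hn.ne'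
    simp [hn']
  have := ((h1.sub (hm.mul h2)).sub (hm.mul h3)).add ((hm.mul hm).mul h4)
  refine (this.congr fun n => ?_).trans
    (by rw [show m ^ 2 + c - m * m - m * m + m * m * 1 = c by ring])
  simp only [sampleAutocov, sub_mul, mul_sub, sum_sub_distrib, ← mul_sum, ← sum_mul]
  simp only [sum_const, nsmul_eq_mul]
  ring

lemma tendsto_sampleVariance (hx : Tendsto (fun n : ℕ => (∑ i ∈ range n, x i) / n) atTop (𝓝 m))
    {c : ℝ} (hc : Tendsto (fun n : ℕ => (∑ i ∈ range n, x i * x i) / n) atTop (𝓝 (m ^ 2 + c))) :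
    Tendsto (sampleVariance x) atTop (𝓝 c) := by
  refine (tendsto_sampleAutocov (h := 0) hx hc).congr fun n => ?_
  simp [sampleAutocov, sampleVariance, sq]

end Averages

/-! ### Strong laws for autoregressive sequences -/

section Autoregression

variable {Ω : Type*} {mΩ : MeasurableSpace Ω} {P : Measure Ω} [IsProbabilityMeasure P]

/-- Averages of predictable multiples of centred innovations vanish almost surely: the series
`∑ W_i e_i / (i + 1)` is an `L²`-bounded martingale, hence converges, and Kronecker's lemma
applies. -/
lemma ae_tendsto_average_mul_innovation {𝓖 : Filtration ℕ mΩ} {W e : ℕ → Ω → ℝ}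
    (hW : ∀ i, Measurable[𝓖 i] (W i)) (he : ∀ i, Measurable[𝓖 (i + 1)] (e i))
    (hind : ∀ i, Indep (MeasurableSpace.comap (e i) inferInstance) (𝓖 i) P)
    (hW2 : ∀ i, MemLp (W i) 2 P) (he2 : ∀ i, MemLp (e i) 2 P) (he0 : ∀ i, ∫ ω, e i ω ∂P = 0)
    {C : ℝ} (hC : ∀ i, (∫ ω, W i ω ^ 2 ∂P) * ∫ ω, e i ω ^ 2 ∂P ≤ C) :
    ∀ᵐ ω ∂P, Tendsto (fun n : ℕ => (∑ i ∈ range n, W i ω * e i ω) / n) atTop (𝓝 0) := by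
  have hWm : ∀ i, Measurable (W i) := fun i => (hW i).mono (𝓖.le i) le_rfl
  have hem : ∀ i, Measurable (e i) := fun i => (he i).mono (𝓖.le _) le_rfl
  have hindep : ∀ i {V : Ω → ℝ}, Measurable[𝓖 i] V → IndepFun V (e i) P := fun i V hV =>
    (indep_of_indep_of_le_right (hind i) hV.comap_le).symm
  have hD2 : ∀ i, MemLp (fun ω => W i ω * e i ω) 2 P := by
    intro i
    rw [memLp_two_iff_integrable_sq (f := fun ω => W i ω * e i ω)
      ((hWm i).mul (hem i)).aestronglyMeasurable]
    have := ((hindep i (hW i)).comp (measurable_id.pow_const 2)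
      (measurable_id.pow_const 2)).integrable_mul (hW2 i).integrable_sq (he2 i).integrable_sq
    refine this.congr (ae_of_all _ fun ω => ?_)
    simp [mul_pow]
  set T : ℕ → Ω → ℝ := fun n ω => ∑ i ∈ range n, W i ω * e i ω / ((i : ℝ) + 1) with hT
  have hT2 : ∀ n, MemLp (T n) 2 P := fun n => memLp_finsetSum _ fun i _ => by
    simpa [div_eq_mul_inv] using (hD2 i).mul_const (((i : ℝ) + 1)⁻¹)
  have hTm : ∀ n, Measurable[𝓖 n] (T n) := fun n => Finset.measurable_sum _ fun i hi => by
    have hi := mem_range.1 hi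
    exact (((hW i).mono (𝓖.mono hi.le) le_rfl).mul
      ((he i).mono (𝓖.mono hi) le_rfl)).div_const _
  have hTsucc : ∀ n, T (n + 1) = fun ω => T n ω + W n ω * e n ω / ((n : ℝ) + 1) := fun n => by
    ext ω
    exact sum_range_succ _ _
  have hmart : Martingale T 𝓖 P := by
    refine martingale_of_condExp_sub_eq_zero_nat (fun n => (hTm n).stronglyMeasurable)
      (fun n => (hT2 n).integrable (by simp)) fun n => ?_
    have hfun : T (n + 1) - T n = (fun ω => W n ω / ((n : ℝ) + 1)) * e n := by
      ext ω
      simp only [hTsucc, Pi.sub_apply, Pi.mul_apply]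
      ring
    rw [hfun]
    have hWn : StronglyMeasurable[𝓖 n] (fun ω => W n ω / ((n : ℝ) + 1)) :=
      ((hW n).div_const _).stronglyMeasurable
    have hint : Integrable ((fun ω => W n ω / ((n : ℝ) + 1)) * e n) P := by
      rw [← hfun]
      exact ((hT2 _).sub (hT2 _)).integrable (by simp)
    have h1 := condExp_mul_of_stronglyMeasurable_left hWn hint ((he2 n).integrable (by simp))
    have h2 := condExp_indep_eq (hem n).comap_le (𝓖.le n)
      (comap_measurable (e n)).stronglyMeasurable (hind n)
    filter_upwards [h1, h2] with ω h1 h2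
    rw [h1, Pi.mul_apply, h2, he0, mul_zero, Pi.zero_apply]
  have hsq : ∀ n, ∫ ω, T n ω ^ 2 ∂P ≤ C * ∑ i ∈ range n, 1 / ((i : ℝ) + 1) ^ 2 := by
    intro n
    induction n with
    | zero => simp [hT]
    | succ n ih =>
      have hTW : Measurable[𝓖 n] (fun ω => T n ω * W n ω) := (hTm n).mul (hW n)
      have hcross : ∫ ω, T n ω * (W n ω * e n ω) ∂P = 0 := by
        have := (hindep n hTW).integral_fun_mul_eq_mul_integral
          (hTW.mono (𝓖.le n) le_rfl).aestronglyMeasurable (hem n).aestronglyMeasurable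
        rw [he0, mul_zero] at this
        simpa [mul_assoc] using this
      have hquad : ∫ ω, (W n ω * e n ω) ^ 2 ∂P ≤ C := by
        have := ((hindep n (hW n)).comp (measurable_id.pow_const 2)
          (measurable_id.pow_const 2)).integral_fun_mul_eq_mul_integral
          ((hWm n).pow_const 2).aestronglyMeasurable ((hem n).pow_const 2).aestronglyMeasurable
        simp only [Function.comp_apply, id, ← mul_pow] at this
        rw [this]
        exact hC n
      have hexp : ∀ ω, T (n + 1) ω ^ 2 = T n ω ^ 2 + (2 / ((n : ℝ) + 1) *
          (T n ω * (W n ω * e n ω)) + 1 / ((n : ℝ) + 1) ^ 2 * (W n ω * e n ω) ^ 2) := by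
        intro ω
        rw [hTsucc]
        field_simp
        ring
      have i1 : Integrable (fun ω => 2 / ((n : ℝ) + 1) * (T n ω * (W n ω * e n ω))) P :=
        ((hT2 n).integrable_mul (hD2 n)).const_mul _
      have i2 : Integrable (fun ω => 1 / ((n : ℝ) + 1) ^ 2 * (W n ω * e n ω) ^ 2) P :=
        (hD2 n).integrable_sq.const_mul _
      have i12 : Integrable (fun ω => 2 / ((n : ℝ) + 1) * (T n ω * (W n ω * e n ω)) +
          1 / ((n : ℝ) + 1) ^ 2 * (W n ω * e n ω) ^ 2) P := i1.add i2
      simp_rw [hexp]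
      rw [integral_add (hT2 n).integrable_sq i12, integral_add i1 i2, integral_const_mul,
        integral_const_mul, hcross, sum_range_succ, mul_add]
      have : 1 / ((n : ℝ) + 1) ^ 2 * ∫ ω, (W n ω * e n ω) ^ 2 ∂P ≤ C * (1 / ((n : ℝ) + 1) ^ 2) := by
        rw [mul_comm]
        exact mul_le_mul_of_nonneg_right hquad (by positivity)
      linarith
  have hC0 : 0 ≤ C := (mul_nonneg (integral_nonneg fun ω => sq_nonneg _)
    (integral_nonneg fun ω => sq_nonneg _)).trans (hC 0)
  have hsummable : Summable fun i : ℕ => 1 / ((i : ℝ) + 1) ^ 2 := by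
    have := (summable_nat_add_iff 1).2 (Real.summable_one_div_nat_pow.2 (one_lt_two))
    simpa using this
  set R : ℝ := C * ∑' i : ℕ, 1 / ((i : ℝ) + 1) ^ 2 with hR
  have hbdd : ∀ n, eLpNorm (T n) 1 P ≤ (Real.toNNReal √R : ℝ≥0) := by
    intro n
    refine (eLpNorm_le_eLpNorm_of_exponent_le (by norm_num) (hT2 n).1).trans
      ((eLpNorm_two_eq_sqrt_integral_sq (hT2 n)).trans_le ?_)
    refine ENNReal.ofReal_le_ofReal (Real.sqrt_le_sqrt ((hsq n).trans ?_))
    exact mul_le_mul_of_nonneg_left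
      (hsummable.sum_le_tsum _ fun i _ => by positivity) hC0
  filter_upwards [hmart.submartingale.ae_tendsto_limitProcess hbdd] with ω hω
  exact tendsto_average_zero_of_tendsto_sum_div hω

/-- Strong laws of large numbers for `X_{i+1} = a X_i + e_i` with square integrable innovations
`e_i` that are identically distributed and independent of the past: the averages of `X_i` and of
`X_{i+h} X_i` converge to the stationary mean and second mixed moment. -/
lemma ae_tendsto_average_of_autoregression {𝓖 : Filtration ℕ mΩ} {X e : ℕ → Ω → ℝ} {a C : ℝ}
    (ha0 : 0 ≤ a) (ha1 : a < 1)
    (hX : ∀ i, Measurable[𝓖 i] (X i)) (he : ∀ i, Measurable[𝓖 (i + 1)] (e i))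
    (hind : ∀ i, Indep (MeasurableSpace.comap (e i) inferInstance) (𝓖 i) P)
    (hX2 : ∀ i, MemLp (X i) 2 P) (hC : ∀ i, ∫ ω, X i ω ^ 2 ∂P ≤ C) (he2 : MemLp (e 0) 2 P)
    (hid : ∀ i, IdentDistrib (e i) (e 0) P P)
    (hrec : ∀ i ω, X (i + 1) ω = a * X i ω + e i ω) {m : ℝ} (hm : ∫ ω, e 0 ω ∂P = m * (1 - a)) :
    ∀ᵐ ω ∂P, Tendsto (fun n : ℕ => (∑ i ∈ range n, X i ω) / n) atTop (𝓝 m) ∧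
      ∀ h : ℕ, Tendsto (fun n : ℕ => (∑ i ∈ range n, X (i + h) ω * X i ω) / n) atTop
        (𝓝 (m ^ 2 + a ^ h * (variance (e 0) P / (1 - a ^ 2)))) := by
  have hem : ∀ i, Measurable (e i) := fun i => (he i).mono (𝓖.le _) le_rfl
  have he2' : ∀ i, MemLp (e i) 2 P := fun i => (hid i).symm.memLp_snd he2
  have hpair : Pairwise fun i j => IndepFun (e i) (e j) P := by
    have hlt : ∀ i j, i < j → IndepFun (e i) (e j) P := fun i j hij =>
      (indep_of_indep_of_le_right (hind j)
        (((he i).mono (𝓖.mono hij) le_rfl).comap_le)).symm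
    intro i j hij
    rcases lt_or_gt_of_ne hij with h | h
    · exact hlt i j h
    · exact (hlt j i h).symm
  have hslln := strong_law_ae_real e (he2.integrable (by simp)) hpair hid
  have hslln2 := strong_law_ae_real (fun i ω => e i ω ^ 2) he2.integrable_sq
    (fun i j hij => (hpair hij).comp (measurable_id.pow_const 2) (measurable_id.pow_const 2))
    (fun i => (hid i).sq)
  set b := ∫ ω, e 0 ω ∂P with hb
  have hcentred : ∀ h : ℕ, ∀ᵐ ω ∂P,
      Tendsto (fun n : ℕ => (∑ i ∈ range n, X i ω * (e (i + h) ω - b)) / n) atTop (𝓝 0) := by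
    intro h
    -- the filtration is shifted by `h`, so that `X i` is predictable and `e (i + h)` is new
    let 𝓗 : Filtration ℕ mΩ := ⟨fun i => 𝓖 (i + h), fun i j hij => 𝓖.mono (by omega),
      fun i => 𝓖.le _⟩
    have hmeas : ∀ i, Measurable[𝓖 (i + h + 1)] (fun ω => e (i + h) ω - b) := fun i =>
      (he (i + h)).sub_const b
    refine ae_tendsto_average_mul_innovation (𝓖 := 𝓗) (W := X)
      (e := fun i ω => e (i + h) ω - b) (C := C * variance (e 0) P)
      (fun i => (hX i).mono (𝓖.mono (by omega)) le_rfl)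
      (fun i => (hmeas i).mono (𝓖.mono (by omega)) le_rfl) (fun i => ?_) hX2
      (fun i => (he2' _).sub (memLp_const b)) (fun i => ?_) fun i => ?_
    · refine indep_of_indep_of_le_left (hind (i + h)) ?_
      rintro _ ⟨B, hB, rfl⟩
      exact ⟨(fun x => x - b) ⁻¹' B, (measurable_id.sub_const b) hB, rfl⟩
    · rw [integral_sub ((he2' _).integrable (by simp)) (integrable_const _),
        (hid (i + h)).integral_eq]
      simp [hb]
    · have : ∫ ω, (e (i + h) ω - b) ^ 2 ∂P = variance (e 0) P := by
        rw [← (hid (i + h)).variance_eq, variance_eq_integral (hem _).aemeasurable,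
          (hid (i + h)).integral_eq]
      rw [this]
      exact mul_le_mul_of_nonneg_right (hC i) (variance_nonneg _ _)
  have ha2 : a ^ 2 < 1 := by nlinarith
  have h1a : 1 - a ≠ 0 := (sub_pos.2 ha1).ne'
  have h1a2 : 1 - a ^ 2 ≠ 0 := (sub_pos.2 ha2).ne'
  have hvar : ∫ ω, e 0 ω ^ 2 ∂P = variance (e 0) P + b ^ 2 := by
    have := variance_eq_sub he2
    simp only [Pi.pow_apply] at this
    rw [this]
    ring
  filter_upwards [hslln, hslln2, ae_all_iff.2 hcentred] with ω h1 h2 h3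
  have hmean : Tendsto (fun n : ℕ => (∑ i ∈ range n, X i ω) / n) atTop (𝓝 m) := by
    have := tendsto_average_of_recursion (s := fun i => X i ω) ha0 ha1
      (fun i => hrec i ω) h1
    rwa [hm, mul_div_cancel_right₀ _ h1a] at this
  have hXe : ∀ h : ℕ, Tendsto (fun n : ℕ => (∑ i ∈ range n, X i ω * e (i + h) ω) / n) atTop
      (𝓝 (m * b)) := by
    intro h
    have := (h3 h).add (hmean.mul_const b)
    rw [zero_add] at this
    refine this.congr fun n => ?_
    simp only [mul_sub, sum_sub_distrib, ← sum_mul]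
    ring
  refine ⟨hmean, fun h => ?_⟩
  induction h with
  | zero =>
    have hr : Tendsto (fun n : ℕ =>
        (∑ i ∈ range n, (2 * a * (X i ω * e i ω) + e i ω ^ 2)) / (n : ℝ)) atTop
        (𝓝 (2 * a * (m * b) + ∫ ω, e 0 ω ^ 2 ∂P)) := by
      refine (((hXe 0).const_mul (2 * a)).add h2).congr fun n => ?_
      simp only [sum_add_distrib, ← mul_sum, add_zero]
      ring
    have := tendsto_average_of_recursion (s := fun i => X (i + 0) ω * X i ω) (sq_nonneg a) ha2
      (fun i => by simp only [add_zero, hrec]; ring) hr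
    convert this using 2
    rw [hvar, hm]
    field_simp
    ring
  | succ h ih =>
    have := (ih.const_mul a).add (hXe h)
    have hlim : m ^ 2 + a ^ (h + 1) * (variance (e 0) P / (1 - a ^ 2)) =
        a * (m ^ 2 + a ^ h * (variance (e 0) P / (1 - a ^ 2))) + m * b := by
      rw [hm]; ring
    rw [hlim]
    refine this.congr fun n => ?_
    rw [mul_div_assoc', mul_sum, ← add_div, ← sum_add_distrib]
    congr 1
    refine sum_congr rfl fun i _ => ?_
    rw [← add_assoc, hrec]
    ring

end Autoregression

/-! ### The stationary Ornstein–Uhlenbeck process -/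

section OrnsteinUhlenbeck

lemma integral_exp_const_mul {c : ℝ} (hc : c ≠ 0) (a b : ℝ) :
    ∫ x in a..b, Real.exp (c * x) = (Real.exp (c * b) - Real.exp (c * a)) / c := by
  rw [intervalIntegral.integral_comp_mul_left (fun x => Real.exp x) hc, integral_exp, smul_eq_mul]
  ring

variable {Ω : Type*} {mΩ : MeasurableSpace Ω} {P : Measure Ω} {𝓕 : Filtration ℝ≥0 mΩ}
  {L : ℝ≥0 → Ω → ℝ}

lemma IsStochIntegral.congr {f : ℝ → ℝ} {a b : ℝ≥0} {J K : Ω → ℝ}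
    (hJ : IsStochIntegral P f L a b J) (hJK : J =ᵐ[P] K) : IsStochIntegral P f L a b K :=
  ⟨hJ.1.congr hJK, fun N π hπ hmesh => (hJ.2 N π hπ hmesh).congr_right hJK⟩

/-- Mean and variance of `∫_0^∞ e^{-s} dL_s`: the integrals over `[0, T]` are Cauchy in `L²`. -/
lemma IsImproperStochIntegral.moments_exp_neg [IsProbabilityMeasure P]
    (hL : IsLevyProcess P 𝓕 L) (h1 : MemLp (L 1) 2 P) {Z : Ω → ℝ}
    (hZ : IsImproperStochIntegral P (fun s => Real.exp (-s)) L Z) :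
    MemLp Z 2 P ∧ ∫ ω, Z ω ∂P = ∫ ω, L 1 ω ∂P ∧ variance Z P = variance (L 1) P / 2 := by
  obtain ⟨-, I, hI, hIZ⟩ := hZ
  set m := ∫ ω, L 1 ω ∂P with hm
  set v := variance (L 1) P with hv
  have hv0 : 0 ≤ v := variance_nonneg _ _
  have hcont : Continuous fun s : ℝ => Real.exp (-s) := by fun_prop
  have hmom : ∀ (a s : ℝ≥0) (J : Ω → ℝ),
      IsStochIntegral P (fun s => Real.exp (-s)) L a (a + s) J → MemLp J 2 P ∧
      ∫ ω, J ω ∂P = (Real.exp (-a) - Real.exp (-(a + s))) * m ∧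
      variance J P = (Real.exp (-(2 * a)) - Real.exp (-(2 * (a + s)))) / 2 * v := by
    intro a s J hJ
    obtain ⟨h2, h3, h4⟩ := hJ.moments hL h1 hcont
    refine ⟨h2, h3.trans ?_, h4.trans ?_⟩
    · have := integral_exp_const_mul (c := -1) (by norm_num) a (a + s : ℝ≥0)
      simp only [neg_one_mul] at this
      rw [this]
      push_cast
      ring
    · have := integral_exp_const_mul (c := -2) (by norm_num) a (a + s : ℝ≥0)
      have hsq : ∀ x : ℝ, Real.exp (-x) ^ 2 = Real.exp (-2 * x) := fun x => by
        rw [← Real.exp_nat_mul]; congr 1; push_cast; ring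
      simp_rw [hsq]
      rw [this]
      push_cast
      rw [neg_mul, neg_mul]
      ring
  have hS : ∀ k : ℕ, MemLp (I k) 2 P ∧ ∫ ω, I k ω ∂P = (1 - Real.exp (-k)) * m ∧
      variance (I k) P = (1 - Real.exp (-(2 * k))) / 2 * v := by
    intro k
    simpa using hmom 0 k (I k) (by simpa using hI k)
  set B := v + m ^ 2 with hB
  have hB0 : 0 ≤ B := by positivity
  have hdiff : ∀ j k : ℕ, j ≤ k → ∫ ω, (I k ω - I j ω) ^ 2 ∂P ≤ Real.exp (-j) * B := by
    intro j k hjk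
    obtain ⟨r, rfl⟩ := Nat.exists_eq_add_of_le hjk
    have hsub := (hI j).sub (hI (j + r : ℕ))
    push_cast at hsub
    obtain ⟨h2, h3, h4⟩ := hmom j r _ hsub
    have hvar := variance_eq_sub h2
    rw [h3, h4] at hvar
    simp only [Pi.pow_apply] at hvar
    push_cast at hvar ⊢
    have e1 : Real.exp (-((j : ℝ) + r)) ≤ Real.exp (-j) :=
      Real.exp_le_exp.2 (by linarith [(Nat.cast_nonneg r : (0 : ℝ) ≤ r)])
    have e2 : Real.exp (-(2 * (j : ℝ))) ≤ Real.exp (-j) :=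
      Real.exp_le_exp.2 (by linarith [(Nat.cast_nonneg j : (0 : ℝ) ≤ j)])
    have e3 : Real.exp (-(j : ℝ)) ≤ 1 :=
      Real.exp_le_one_iff.2 (by linarith [(Nat.cast_nonneg j : (0 : ℝ) ≤ j)])
    have e4 := Real.exp_pos (-((j : ℝ) + r))
    have e5 := Real.exp_pos (-(2 * ((j : ℝ) + r)))
    have f1 : (Real.exp (-(j : ℝ)) - Real.exp (-((j : ℝ) + r))) ^ 2 ≤ Real.exp (-(j : ℝ)) := by
      nlinarith [Real.exp_pos (-(j : ℝ))]
    have f2 : (Real.exp (-(2 * (j : ℝ))) - Real.exp (-(2 * ((j : ℝ) + r)))) / 2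
        ≤ Real.exp (-(j : ℝ)) := by
      linarith [Real.exp_pos (-(2 * (j : ℝ)))]
    have g1 := mul_le_mul_of_nonneg_right f1 (sq_nonneg m)
    have g2 := mul_le_mul_of_nonneg_right f2 hv0
    rw [← mul_pow] at g1
    rw [hB, mul_add]
    linarith
  have hC : Tendsto (fun p : ℕ × ℕ => ∫ ω, (I p.1 ω - I p.2 ω) ^ 2 ∂P) atTop (𝓝 0) := by
    have hmin : Tendsto (fun p : ℕ × ℕ => min p.1 p.2) atTop atTop :=
      tendsto_atTop.2 fun b => by
        filter_upwards [eventually_ge_atTop (b, b)] with p hp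
        exact le_min hp.1 hp.2
    have hexp : Tendsto (fun p : ℕ × ℕ => Real.exp (-((min p.1 p.2 : ℕ) : ℝ)) * B) atTop (𝓝 0) := by
      have := (Real.tendsto_exp_neg_atTop_nhds_zero.comp
        (tendsto_natCast_atTop_atTop.comp hmin)).mul_const B
      simpa [Function.comp_def] using this
    refine squeeze_zero (fun p => integral_nonneg fun ω => sq_nonneg _) (fun p => ?_) hexp
    rcases le_total p.1 p.2 with h | h
    · rw [min_eq_left h]
      refine le_trans (le_of_eq ?_) (hdiff _ _ h)
      exact integral_congr_ae (ae_of_all _ fun ω => by simp only; ring)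
    · rw [min_eq_right h]
      exact hdiff _ _ h
  have hlim : TendstoInMeasure P (fun k : ℕ => I k) atTop Z := fun ε hε =>
    (hIZ ε hε).comp tendsto_natCast_atTop_atTop
  obtain ⟨hZ2, hmean, hvar⟩ := moments_of_tendstoInMeasure_of_cauchy (fun k => (hS k).1) hC hlim
  have hexp1 : Tendsto (fun k : ℕ => Real.exp (-(k : ℝ))) atTop (𝓝 0) :=
    Real.tendsto_exp_neg_atTop_nhds_zero.comp tendsto_natCast_atTop_atTop
  have hexp2 : Tendsto (fun k : ℕ => Real.exp (-(2 * (k : ℝ)))) atTop (𝓝 0) :=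
    Real.tendsto_exp_neg_atTop_nhds_zero.comp
      (tendsto_natCast_atTop_atTop.const_mul_atTop two_pos)
  refine ⟨hZ2, tendsto_nhds_unique hmean ?_, tendsto_nhds_unique hvar ?_⟩
  · simp_rw [fun k : ℕ => (hS k).2.1]
    simpa using (hexp1.const_sub 1).mul_const m
  · simp_rw [fun k : ℕ => (hS k).2.2]
    convert ((hexp2.const_sub 1).div_const 2).mul_const v using 2
    ring

namespace IsLevyOU

variable {lam : ℝ≥0} {Y : ℝ≥0 → Ω → ℝ}

/-- The process restarted at time `t` is driven by the integral over `[λ t, λ (t + r)]`. -/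
lemma exists_innovation (hY : IsLevyOU P L lam Y) (t r : ℝ≥0) :
    ∃ D : Ω → ℝ, Measurable D ∧
      IsStochIntegral P (fun s => Real.exp s) L (lam * t) (lam * t + lam * r) D ∧
      ∀ ω, Y (t + r) ω =
        Real.exp (-(lam * r)) * Y t ω + Real.exp (-(lam * (t + r))) * D ω := by
  obtain ⟨J, hJ, hYJ⟩ := hY.eq_integral t
  obtain ⟨J', hJ', hYJ'⟩ := hY.eq_integral (t + r)
  refine ⟨fun ω => Real.exp (lam * (t + r)) * (Y (t + r) ω - Real.exp (-(lam * r)) * Y t ω),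
    ((hY.measurable _).sub ((hY.measurable t).const_mul _)).const_mul _, ?_, fun ω => ?_⟩
  · rw [← mul_add]
    refine (hJ.sub hJ').congr ?_
    filter_upwards [hYJ, hYJ'] with ω h1 h2
    rw [h1, h2]
    push_cast
    have e1 : Real.exp (-(lam * (t + r))) = (Real.exp (lam * t))⁻¹ * (Real.exp (lam * r))⁻¹ := by
      rw [← Real.exp_neg, ← Real.exp_neg, ← Real.exp_add]; congr 1; ring
    have e2 : Real.exp (lam * (t + r)) = Real.exp (lam * t) * Real.exp (lam * r) := by
      rw [← Real.exp_add]; congr 1; ring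
    rw [e1, e2, Real.exp_neg, Real.exp_neg]
    field_simp
    ring
  · rw [← mul_assoc, ← Real.exp_add, neg_add_cancel, Real.exp_zero]
    ring

variable [IsProbabilityMeasure P]

lemma measurable_completedPast (hL : IsLevyProcess P 𝓕 L) (hY : IsLevyOU P L lam Y) (t : ℝ≥0) :
    Measurable[completedPast P L (Y 0) (lam * t)] (Y t) := by
  obtain ⟨J, hJ, hYJ⟩ := hY.eq_integral t
  exact hJ.measurable_completedPast hL (hY.measurable 0) hY.indep (hY.measurable t) hYJ

lemma indep_innovation (hL : IsLevyProcess P 𝓕 L) (hY : IsLevyOU P L lam Y) {t r : ℝ≥0}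
    {D : Ω → ℝ} (hDm : Measurable D)
    (hD : IsStochIntegral P (fun s => Real.exp s) L (lam * t) (lam * t + lam * r) D) :
    Indep (MeasurableSpace.comap D inferInstance) (completedPast P L (Y 0) (lam * t)) P :=
  hD.indep (hL.completedPast (hY.measurable 0) hY.indep) hDm

lemma moments_innovation (hL : IsLevyProcess P 𝓕 L) (h1 : MemLp (L 1) 2 P) {t r : ℝ≥0}
    {D : Ω → ℝ}
    (hD : IsStochIntegral P (fun s => Real.exp s) L (lam * t) (lam * t + lam * r) D) :
    MemLp D 2 P ∧
    ∫ ω, D ω ∂P = (Real.exp (lam * (t + r)) - Real.exp (lam * t)) * ∫ ω, L 1 ω ∂P ∧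
    variance D P = (Real.exp (lam * (t + r)) ^ 2 - Real.exp (lam * t) ^ 2) / 2
      * variance (L 1) P := by
  obtain ⟨h2, h3, h4⟩ := hD.moments hL h1 Real.continuous_exp
  have hsq : ∀ x : ℝ, Real.exp x ^ 2 = Real.exp (2 * x) := fun x => by
    rw [← Real.exp_nat_mul]; rfl
  refine ⟨h2, h3.trans ?_, h4.trans ?_⟩
  · rw [integral_exp]
    push_cast
    rw [mul_add]
  · simp_rw [hsq]
    rw [integral_exp_const_mul two_ne_zero]
    push_cast
    rw [mul_add (lam : ℝ)]

/-- Started from a variable with the mean and variance of the invariant law, the process keeps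
this mean and variance. -/
lemma moments (hL : IsLevyProcess P 𝓕 L) (h1 : MemLp (L 1) 2 P) (hY : IsLevyOU P L lam Y)
    (h0 : MemLp (Y 0) 2 P) (hmean : ∫ ω, Y 0 ω ∂P = ∫ ω, L 1 ω ∂P)
    (hvar : variance (Y 0) P = variance (L 1) P / 2) (t : ℝ≥0) :
    MemLp (Y t) 2 P ∧ ∫ ω, Y t ω ∂P = ∫ ω, L 1 ω ∂P ∧
      variance (Y t) P = variance (L 1) P / 2 := by
  obtain ⟨D, hDm, hD, hYD⟩ := hY.exists_innovation 0 t
  obtain ⟨hD2, hDmean, hDvar⟩ := moments_innovation hL h1 hD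
  have hind : IndepFun (Y 0) D P :=
    (indep_of_indep_of_le_right (hY.indep_innovation hL hDm hD)
      (hY.measurable_completedPast hL 0).comap_le).symm
  simp only [zero_add, NNReal.coe_zero, mul_zero, Real.exp_zero] at hYD hDmean hDvar
  set a := Real.exp (-(lam * t)) with ha
  have haE : a * Real.exp (lam * t) = 1 := by
    rw [ha, ← Real.exp_add, neg_add_cancel, Real.exp_zero]
  have hfun : Y t = (fun ω => a * Y 0 ω) + fun ω => a * D ω := funext hYD
  refine ⟨hfun ▸ (h0.const_mul a).add (hD2.const_mul a), ?_, ?_⟩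
  · simp_rw [hYD]
    rw [integral_add ((h0.const_mul a).integrable (by simp))
      ((hD2.const_mul a).integrable (by simp)), integral_const_mul, integral_const_mul, hmean,
      hDmean]
    linear_combination (∫ ω, L 1 ω ∂P) * haE
  · rw [hfun, IndepFun.variance_add (h0.const_mul a) (hD2.const_mul a)
      (hind.comp (measurable_const_mul a) (measurable_const_mul a)), variance_const_mul,
      variance_const_mul, hvar, hDvar]
    linear_combination (variance (L 1) P / 2) * (a * Real.exp (lam * t) + 1) * haE

lemma covariance_eq (hL : IsLevyProcess P 𝓕 L) (h1 : MemLp (L 1) 2 P) (hY : IsLevyOU P L lam Y)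
    {t : ℝ≥0} (ht : MemLp (Y t) 2 P) (r : ℝ≥0) :
    covariance (Y (t + r)) (Y t) P = variance (Y t) P * Real.exp (-(lam * r)) := by
  obtain ⟨D, hDm, hD, hYD⟩ := hY.exists_innovation t r
  obtain ⟨hD2, -, -⟩ := moments_innovation hL h1 hD
  have hind : IndepFun D (Y t) P := indep_of_indep_of_le_right (hY.indep_innovation hL hDm hD)
      (hY.measurable_completedPast hL t).comap_le
  have hfun : Y (t + r) = (fun ω => Real.exp (-(lam * r)) * Y t ω) +
    fun ω => Real.exp (-(lam * (t + r))) * D ω := funext hYD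
  rw [hfun, covariance_add_left (ht.const_mul _) (hD2.const_mul _) ht,
    covariance_const_mul_left, covariance_const_mul_left, hind.covariance_eq_zero hD2 ht,
    covariance_self ht.1.aemeasurable]
  ring

/-- Strong laws for the equidistant observations, which form an autoregressive sequence. -/
lemma ae_tendsto_average (hL : IsLevyProcess P 𝓕 L) (h1 : MemLp (L 1) 2 P)
    (hY : IsLevyOU P L lam Y) (hlam : 0 < lam) (h0 : MemLp (Y 0) 2 P)
    (hmean : ∫ ω, Y 0 ω ∂P = ∫ ω, L 1 ω ∂P) (hvar : variance (Y 0) P = variance (L 1) P / 2)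
    {Δ : ℝ≥0} (hΔ : 0 < Δ) :
    ∀ᵐ ω ∂P, Tendsto (fun n : ℕ => (∑ i ∈ range n, Y (i * Δ) ω) / n) atTop (𝓝 (∫ ω, L 1 ω ∂P)) ∧
      ∀ h : ℕ, Tendsto (fun n : ℕ => (∑ i ∈ range n, Y ((i + h : ℕ) * Δ) ω * Y (i * Δ) ω) / n)
        atTop (𝓝 ((∫ ω, L 1 ω ∂P) ^ 2 +
          variance (L 1) P / 2 * Real.exp (-(lam * (h * Δ))))) := by
  set m := ∫ ω, L 1 ω ∂P with hm
  set v := variance (L 1) P with hv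
  set a := Real.exp (-(lam * Δ)) with ha
  have ha1 : a < 1 := by
    rw [ha, Real.exp_lt_one_iff, neg_lt_zero]
    exact mul_pos hlam hΔ
  have ha0 : 0 < a := Real.exp_pos _
  have hmom := fun t => moments hL h1 hY h0 hmean hvar t
  choose D hDm hD hYD using fun i : ℕ => hY.exists_innovation (i * Δ) Δ
  set e : ℕ → Ω → ℝ := fun i ω => Real.exp (-(lam * ((i * Δ : ℝ≥0) + Δ))) * D i ω with he
  let 𝓖 : Filtration ℕ mΩ := ⟨fun i => completedPast P L (Y 0) (lam * (i * Δ)),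
    fun i j hij => (completedPast P L (Y 0)).mono (by gcongr), fun i => Filtration.le _ _⟩
  have hrec : ∀ i ω, Y ((i + 1 : ℕ) * Δ) ω = a * Y (i * Δ) ω + e i ω := by
    intro i ω
    have := hYD i ω
    rw [show (i : ℝ≥0) * Δ + Δ = (i + 1 : ℕ) * Δ by push_cast; ring] at this
    exact this
  have hX : ∀ i : ℕ, Measurable[𝓖 i] (Y (i * Δ)) := fun i => hY.measurable_completedPast hL _
  have heq : ∀ i, e i = fun ω => Y ((i + 1 : ℕ) * Δ) ω - a * Y (i * Δ) ω := fun i => by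
    ext ω
    rw [hrec]
    ring
  have hem : ∀ i, Measurable[𝓖 (i + 1)] (e i) := by
    intro i
    rw [heq]
    exact (hX (i + 1)).sub (((hX i).mono (𝓖.mono i.le_succ) le_rfl).const_mul a)
  have hind : ∀ i, Indep (MeasurableSpace.comap (e i) inferInstance) (𝓖 i) P := by
    intro i
    refine indep_of_indep_of_le_left (hY.indep_innovation hL (hDm i) (hD i)) ?_
    rintro _ ⟨B, hB, rfl⟩
    exact ⟨_, (measurable_const_mul (Real.exp (-(lam * ((i * Δ : ℝ≥0) + Δ))))) hB, rfl⟩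
  have hsecond : ∀ i : ℕ, ∫ ω, Y (i * Δ) ω ^ 2 ∂P ≤ v / 2 + m ^ 2 := by
    intro i
    obtain ⟨g1, g2, g3⟩ := hmom (i * Δ)
    have := variance_eq_sub g1
    rw [g2, g3] at this
    simp only [Pi.pow_apply] at this
    linarith
  obtain ⟨hD2, hDmean, hDvar⟩ := moments_innovation hL h1 (hD 0)
  have hid : ∀ i, IdentDistrib (e i) (e 0) P P := by
    intro i
    have h2 := (hD i).identDistrib hL (hD 0) (C := Real.exp (lam * (i * Δ))) fun x => by
      rw [← Real.exp_add]
      congr 1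
      push_cast
      ring
    have h3 := h2.const_mul (Real.exp (-(lam * ((i * Δ : ℝ≥0) + Δ))))
    convert h3 using 1
    ext ω
    simp only [he]
    rw [← mul_assoc, ← Real.exp_add]
    congr 2
    push_cast
    ring
  simp only [Nat.cast_zero, zero_mul, NNReal.coe_zero, zero_add, mul_zero, Real.exp_zero]
    at hDmean hDvar
  have haE : a * Real.exp (lam * Δ) = 1 := by
    rw [ha, ← Real.exp_add, neg_add_cancel, Real.exp_zero]
  have he0 : e 0 = fun ω => a * D 0 ω := by
    ext ω
    simp [he, ha]
  have hemean : ∫ ω, e 0 ω ∂P = m * (1 - a) := by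
    rw [he0, integral_const_mul, hDmean]
    linear_combination m * haE
  have hevar : variance (e 0) P / (1 - a ^ 2) = v / 2 := by
    rw [div_eq_iff (by nlinarith), he0, variance_const_mul, hDvar]
    linear_combination (v / 2) * (a * Real.exp (lam * Δ) + 1) * haE
  have hmain := ae_tendsto_average_of_autoregression (𝓖 := 𝓖) (X := fun i => Y (i * Δ)) (e := e)
    (a := a) ha0.le ha1 hX hem hind (fun i => (hmom _).1) hsecond
    (he0 ▸ hD2.const_mul a) hid hrec hemean
  filter_upwards [hmain] with ω hω
  refine ⟨hω.1, fun h => ?_⟩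
  have := hω.2 h
  rw [hevar, ha, ← Real.exp_nat_mul] at this
  convert this using 3
  rw [mul_comm]
  congr 2
  ring

end IsLevyOU

end OrnsteinUhlenbeck

theorem theorem3p2 {Ω : Type*} {mΩ : MeasurableSpace Ω} (P : Measure Ω) [IsProbabilityMeasure P]
    (𝓕 : Filtration ℝ≥0 mΩ) (L : ℝ≥0 → Ω → ℝ) (hL : IsLevyProcess P 𝓕 L)
    (F : Measure ℝ) (hF : HasLevyMeasure (P.map (L 1)) F)
    (M : ℝ) (hM : 0 < M)
    (hexp : ∀ v : ℝ, |v| ≤ M → IntegrableOn (fun x : ℝ => Real.exp (v * x)) {x | 1 < |x|} F)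
    (μ σ : ℝ) (hμ : μ = ∫ ω, L 1 ω ∂P) (hσ : σ ^ 2 = variance (L 1) P)
    (lam : ℝ≥0) (hlam : 0 < lam)
    (Y : ℝ≥0 → Ω → ℝ) (hY : IsLevyOU P L lam Y)
    (Z : Ω → ℝ) (hZ : IsImproperStochIntegral P (fun s => Real.exp (-s)) L Z)
    (hY0 : IdentDistrib (Y 0) Z P P)
    (Δ : ℝ≥0) (hΔ : 0 < Δ) (d : ℕ) :
    -- the moments below are finite
    (MemLp (L 1) 2 P ∧ ∀ t : ℝ≥0, MemLp (Y t) 2 P) ∧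
    -- the autocovariance and autocorrelation functions of the observations
    (∀ (t : ℝ≥0) (h : ℕ), covariance (Y (t + h * Δ)) (Y t) P
        = σ ^ 2 / 2 * Real.exp (-(lam * (h * Δ)))) ∧
    (0 < σ ^ 2 → ∀ (t : ℝ≥0) (h : ℕ), correlation (Y (t + h * Δ)) (Y t) P
        = Real.exp (-(lam * (h * Δ)))) ∧
    -- sample mean
    (∀ᵐ ω ∂P, Tendsto (fun n => sampleMean (fun i => Y (i * Δ) ω) n) atTop (𝓝 μ)) ∧
    -- sample variance
    (∀ᵐ ω ∂P, Tendsto (fun n => sampleVariance (fun i => Y (i * Δ) ω) n) atTop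
        (𝓝 (σ ^ 2 / 2))) ∧
    -- sample autocovariances at the lags 1, …, d
    (∀ᵐ ω ∂P, Tendsto
        (fun n => fun k : Fin d => sampleAutocov (fun i => Y (i * Δ) ω) n (k + 1)) atTop
        (𝓝 (fun k : Fin d => σ ^ 2 / 2 * Real.exp (-(lam * (((k : ℝ) + 1) * Δ)))))) ∧
    -- sample autocorrelations at the lags 1, …, d
    (0 < σ ^ 2 → ∀ᵐ ω ∂P, Tendsto
        (fun n => fun k : Fin d => sampleAutocorr (fun i => Y (i * Δ) ω) n (k + 1)) atTop
        (𝓝 (fun k : Fin d => Real.exp (-(lam * (((k : ℝ) + 1) * Δ)))))) := by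
  have hL1 : Measurable (L 1) := hL.measurable 1
  have : IsProbabilityMeasure (P.map (L 1)) := Measure.isProbabilityMeasure_map hL1.aemeasurable
  have h1 : MemLp (L 1) 2 P :=
    (memLp_map_measure_iff (by fun_prop) hL1.aemeasurable).1
      (memLp_two_of_hasLevyMeasure hF hM hexp)
  obtain ⟨hZ2, hZmean, hZvar⟩ := hZ.moments_exp_neg hL h1
  have h0 : MemLp (Y 0) 2 P := hY0.symm.memLp_snd hZ2
  have hmean : ∫ ω, Y 0 ω ∂P = ∫ ω, L 1 ω ∂P := hY0.integral_eq.trans hZmean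
  have hvar : variance (Y 0) P = variance (L 1) P / 2 := hY0.variance_eq.trans hZvar
  have hmom := fun t => IsLevyOU.moments hL h1 hY h0 hmean hvar t
  have hlln := IsLevyOU.ae_tendsto_average hL h1 hY hlam h0 hmean hvar hΔ
  rw [← hμ, ← hσ] at hlln
  rw [← hσ] at hmom
  have hcov : ∀ (t : ℝ≥0) (h : ℕ), covariance (Y (t + h * Δ)) (Y t) P
      = σ ^ 2 / 2 * Real.exp (-(lam * (h * Δ))) := by
    intro t h
    rw [IsLevyOU.covariance_eq hL h1 hY (hmom t).1, (hmom t).2.2]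
    push_cast
    rfl
  have hautocov : ∀ᵐ ω ∂P, ∀ h : ℕ, Tendsto
      (fun n => sampleAutocov (fun i => Y (i * Δ) ω) n h) atTop
      (𝓝 (σ ^ 2 / 2 * Real.exp (-(lam * (h * Δ))))) := by
    filter_upwards [hlln] with ω hω h
    exact tendsto_sampleAutocov hω.1 (hω.2 h)
  refine ⟨⟨h1, fun t => (hmom t).1⟩, hcov, fun hpos t h => ?_, ?_, ?_, ?_, fun hpos => ?_⟩
  · rw [correlation, hcov, (hmom _).2.2, (hmom t).2.2, Real.mul_self_sqrt (by positivity)]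
    have hσ0 : σ ≠ 0 := fun h => by simp [h] at hpos
    field_simp
  · filter_upwards [hlln] with ω hω
    exact tendsto_sampleMean hω.1
  · filter_upwards [hlln] with ω hω
    have := hω.2 0
    simp only [add_zero, Nat.cast_zero, zero_mul, mul_zero, neg_zero, Real.exp_zero,
      mul_one] at this
    exact tendsto_sampleVariance hω.1 this
  · filter_upwards [hautocov] with ω hω
    refine tendsto_pi_nhds.2 fun k => ?_
    simpa using hω (k + 1)
  · filter_upwards [hautocov] with ω hω
    refine tendsto_pi_nhds.2 fun k => ?_
    have h2 := (hω (k + 1)).div (hω 0) (by positivity)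
    simp only [Nat.cast_zero, zero_mul, mul_zero, neg_zero, Real.exp_zero, mul_one] at h2
    rw [mul_div_cancel_left₀ _ (by positivity)] at h2
    push_cast at h2
    exact h2
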